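/- Let $X$ be a complex manifold (of finite dimension), $E\to X$ a holomorphic vector bundle of finite rank and $h$ a hermitian metric in $E$, i.e. a $C^\infty$ field of hermitian inner products on the fibres, linear in the first and conjugate-linear in the second slot. Write $A^{p,q}(\mathrm{End}\,E)$ for the $C^\infty$ forms of type $(p,q)$ with values in $\mathrm{End}\,E$. A Chern connection of $h$ is a connection $D_h=D_h'+D_h''$ in $E$ with $D_h''=d''$ (the $\bar\partial$-operator of $E$) and $d\,h(s,s')=h(D_hs,s')+h(s,D_hs')$ for all sections $s,s'$; its curvature is $F_h=D_h\wedge D_h$. For $\mathrm{End}\,E$-valued $1$-forms put $[\Phi,\Psi]=\Phi\wedge\Psi+\Psi\wedge\Phi$, and for $\Phi\in A^{1,0}(\mathrm{End}\,E)$ let $\bar\Phi_h\in A^{0,1}(\mathrm{End}\,E)$ be its hermitian conjugate, given by $h(\bar\Phi_hs,s')=h(s,\Phi s')$. A Higgs field is a holomorphic $\Phi\in A^{1,0}(\mathrm{End}\,E)$ with $\Phi\wedge\Phi=0$. Then $h$ has a Chern connection $D_h$, and: 1. $F_h\in A^{1,1}(\mathrm{End}\,E)$; that is, $F_h=F_h^{1,1}$,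 and in particular $F_h^{2,0}=0$. 2. For every $\Phi\in A^{1,0}(\mathrm{End}\,E)$, $[\Phi,\Phi]=0$ if and only if $\Phi\wedge\Phi=0$; in particular $[\Phi,\Phi]=0$ for every Higgs field $\Phi$. 3. For every Higgs field $\Phi$, $D_h''\Phi=0$ and $D_h\Phi=D_h'\Phi$; hence $D_h\Phi=0$ if and only if $D_h'\Phi=0$. 4. For every Higgs field $\Phi$, the rescaled form $\Psi=\tfrac12\Phi$ is again a Higgs field, and Ward's system ($2k$-Hitchin equations) $$D_h\Phi=0,\qquad F_h^{1,1}+\tfrac14[\Phi,\bar\Phi_h]=0,\qquad [\Phi,\Phi]=0,\qquad F_h^{2,0}=0$$ holds for $\Phi$ if and only if $\Psi$ satisfies the two equations $$D_h'\Psi=0,\qquad F_h+[\Psi,\bar\Psi_h]=0.$$ -/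

import Mathlib

open Bundle
open scoped Manifold ContDiff Topology ComplexConjugate

noncomputable section

namespace HiggsBundle

/-! ### Complex manifolds and complex vector bundles as real smooth objects -/

section Real

variable {V : Type*} [NormedAddCommGroup V] [NormedSpace ℂ V]
  {X : Type*} [TopologicalSpace X] [ChartedSpace V X]

/-- A complex manifold is a smooth real manifold (with the same charts). -/
instance instIsManifoldReal [IsManifold 𝓘(ℂ, V) ω X] : IsManifold 𝓘(ℝ, V) ∞ X := by
  refine isManifold_of_contDiffOn 𝓘(ℝ, V) ∞ X fun e e' he he' ↦ ?_
  have h := (contDiffGroupoid ω 𝓘(ℂ, V)).compatible he he'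
  have h1 := (contDiffGroupoid_le (I := 𝓘(ℂ, V)) (m := ∞) (n := ω) le_top) h
  have h2 : e.symm ≫ₕ e' ∈ (contDiffPregroupoid ∞ 𝓘(ℂ, V)).groupoid := h1
  exact (mem_groupoid_of_pregroupoid.1 h2).1.restrict_scalars ℝ

instance instContinuousSMulReal {W : Type*} [AddCommGroup W] [Module ℂ W] [TopologicalSpace W]
    [ContinuousSMul ℂ W] : ContinuousSMul ℝ W where
  continuous_smul := by
    have : Continuous fun p : ℝ × W ↦ (p.1 : ℂ) • p.2 := by fun_prop
    exact this

/-- Multiplication by a complex scalar on the real tangent space of a complex manifold. -/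
def scal (c : ℂ) (x : X) : TangentSpace 𝓘(ℝ, V) x →ₗ[ℝ] TangentSpace 𝓘(ℝ, V) x :=
  ((LinearMap.lsmul ℂ V c).restrictScalars ℝ : V →ₗ[ℝ] V)

/-- The complex structure `v ↦ i v` of the real tangent space. -/
def cplx (x : X) : TangentSpace 𝓘(ℝ, V) x →ₗ[ℝ] TangentSpace 𝓘(ℝ, V) x :=
  scal Complex.I x

theorem contMDiffOn_real {G : Type*} [NormedAddCommGroup G] [NormedSpace ℂ G] {f : X → G}
    {u : Set X} (h : ContMDiffOn 𝓘(ℂ, V) 𝓘(ℂ, G) ω f u) : ContMDiffOn 𝓘(ℝ, V) 𝓘(ℝ, G) ∞ f u := by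
  intro x hx
  have h1 := contMDiffWithinAt_iff.1 (h x hx)
  exact contMDiffWithinAt_iff.2 ⟨h1.1, (h1.2.of_le le_top).restrict_scalars ℝ⟩

variable {F : Type*} [NormedAddCommGroup F] [NormedSpace ℂ F]
  {E : X → Type*} [TopologicalSpace (TotalSpace F E)] [∀ x, TopologicalSpace (E x)]
  [FiberBundle F E] [∀ x, AddCommGroup (E x)] [∀ x, Module ℂ (E x)] [VectorBundle ℂ F E]

theorem isLinear_real (e : Trivialization F (π F E)) [MemTrivializationAtlas e] : e.IsLinear ℝ :=
  ⟨fun _ hb ↦ ⟨(e.linear ℂ hb).map_add, fun c v ↦ (e.linear ℂ hb).map_smul (c : ℂ) v⟩⟩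

theorem coordChangeL_real (e e' : Trivialization F (π F E)) [MemTrivializationAtlas e]
    [MemTrivializationAtlas e'] [e.IsLinear ℝ] [e'.IsLinear ℝ] {b : X}
    (hb : b ∈ e.baseSet ∩ e'.baseSet) :
    (e.coordChangeL ℝ e' b : F →L[ℝ] F) =
      ContinuousLinearMap.restrictScalarsL ℂ F F ℝ ℝ (e.coordChangeL ℂ e' b : F →L[ℂ] F) := by
  ext y
  change e.coordChangeL ℝ e' b y = e.coordChangeL ℂ e' b y
  rw [e.coordChangeL_apply (R := ℝ) e' hb, e.coordChangeL_apply (R := ℂ) e' hb]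

/-- A complex vector bundle is a real vector bundle. -/
instance instVectorBundleReal : VectorBundle ℝ F E where
  trivialization_linear' e _ := isLinear_real e
  continuousOn_coordChange' e e' _ _ := by
    have := isLinear_real e
    have := isLinear_real e'
    exact ((ContinuousLinearMap.restrictScalarsL ℂ F F ℝ ℝ).continuous.comp_continuousOn
      (continuousOn_coordChange ℂ e e')).congr fun b hb ↦ coordChangeL_real e e' hb

/-- A holomorphic vector bundle is a `C^∞` real vector bundle. -/
instance instContMDiffVectorBundleReal [ContMDiffVectorBundle ω F E 𝓘(ℂ, V)] :
    ContMDiffVectorBundle ∞ F E 𝓘(ℝ, V) where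
  contMDiffOn_coordChangeL e e' _ _ := by
    have h := contMDiffOn_real
      (ContMDiffVectorBundle.contMDiffOn_coordChangeL (n := ω) (IB := 𝓘(ℂ, V)) e e')
    refine ContMDiffOn.congr ?_ fun b hb ↦ coordChangeL_real e e' hb
    exact (ContinuousLinearMap.contMDiff
      (ContinuousLinearMap.restrictScalarsL ℂ F F ℝ ℝ)).comp_contMDiffOn h

end Real

section Sections

variable (V : Type*) [NormedAddCommGroup V] [NormedSpace ℂ V]
  {X : Type*} [TopologicalSpace X] [ChartedSpace V X]
  (F : Type*) [NormedAddCommGroup F] [NormedSpace ℂ F]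
  {E : X → Type*} [TopologicalSpace (TotalSpace F E)] [∀ x, TopologicalSpace (E x)]
  [FiberBundle F E]

/-- The section `s` is `C^∞` (in the real sense) at `x`. -/
def SmoothAt (s : ∀ y, E y) (x : X) : Prop :=
  ContMDiffAt 𝓘(ℝ, V) (𝓘(ℝ, V).prod 𝓘(ℝ, F)) ∞ (fun y ↦ TotalSpace.mk' F y (s y)) x

/-- The section `s` is differentiable (in the real sense) at `x`. -/
def DiffAt (s : ∀ y, E y) (x : X) : Prop :=
  MDifferentiableAt 𝓘(ℝ, V) (𝓘(ℝ, V).prod 𝓘(ℝ, F)) (fun y ↦ TotalSpace.mk' F y (s y)) x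

/-- The section `s` is holomorphic (complex analytic) at `x`. -/
def HolomorphicAt (s : ∀ y, E y) (x : X) : Prop :=
  ContMDiffAt 𝓘(ℂ, V) (𝓘(ℂ, V).prod 𝓘(ℂ, F)) ω (fun y ↦ TotalSpace.mk' F y (s y)) x

variable {V F}

theorem SmoothAt.diffAt {s : ∀ y, E y} {x : X} (h : SmoothAt V F s x) : DiffAt V F s x :=
  ContMDiffAt.mdifferentiableAt h (by simp)

variable [∀ x, AddCommGroup (E x)] [∀ x, Module ℂ (E x)] [VectorBundle ℂ F E]

theorem coord_smul (c : ℂ) (s : ∀ y, E y) (x : X) :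
    (fun y ↦ (trivializationAt F E x (TotalSpace.mk' F y (c • s y))).2) =ᶠ[𝓝 x]
      fun y ↦ c • (trivializationAt F E x (TotalSpace.mk' F y (s y))).2 := by
  filter_upwards [(trivializationAt F E x).open_baseSet.mem_nhds
    (FiberBundle.mem_baseSet_trivializationAt' x)] with y hy
  exact ((trivializationAt F E x).linear ℂ hy).map_smul c (s y)

theorem SmoothAt.smul (c : ℂ) {s : ∀ y, E y} {x : X} (h : SmoothAt V F s x) :
    SmoothAt V F (fun y ↦ c • s y) x := by
  unfold SmoothAt at h ⊢
  rw [contMDiffAt_section] at h ⊢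
  refine ContMDiffAt.congr_of_eventuallyEq ?_ (coord_smul c s x)
  exact (ContinuousLinearMap.contMDiff
    ((ContinuousLinearMap.lsmul ℝ ℂ c : F →L[ℝ] F))).contMDiffAt.comp x h

theorem DiffAt.smul (c : ℂ) {s : ∀ y, E y} {x : X} (h : DiffAt V F s x) :
    DiffAt V F (fun y ↦ c • s y) x := by
  unfold DiffAt at h ⊢
  rw [mdifferentiableAt_section] at h ⊢
  refine MDifferentiableAt.congr_of_eventuallyEq ?_ (coord_smul c s x)
  exact ((ContinuousLinearMap.contMDiff (n := 1)
    ((ContinuousLinearMap.lsmul ℝ ℂ c : F →L[ℝ] F))).mdifferentiableAt one_ne_zero).comp x h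

theorem SmoothAt.eventually_diffAt [IsManifold 𝓘(ℂ, V) ω X] [ContMDiffVectorBundle ω F E 𝓘(ℂ, V)]
    {s : ∀ y, E y} {x : X} (h : SmoothAt V F s x) : ∀ᶠ y in 𝓝 x, DiffAt V F s y :=
  ((contMDiffAt_iff_contMDiffAt_nhds (n := 1) (by simp)).1
    (ContMDiffAt.of_le h (by simp))).mono fun _ hy ↦ ContMDiffAt.mdifferentiableAt hy one_ne_zero

theorem SmoothAt.add [ContMDiffVectorBundle ω F E 𝓘(ℂ, V)]
    {s t : ∀ y, E y} {x : X} (hs : SmoothAt V F s x) (ht : SmoothAt V F t x) :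
    SmoothAt V F (s + t) x :=
  ContMDiffAt.add_section hs ht

end Sections

section Extension

variable (𝕜 : Type*) [NontriviallyNormedField 𝕜]
  {V : Type*} [NormedAddCommGroup V] [NormedSpace 𝕜 V]
  {X : Type*} [TopologicalSpace X] [ChartedSpace V X]
  (F : Type*) [NormedAddCommGroup F] [NormedSpace 𝕜 F]
  {E : X → Type*} [TopologicalSpace (TotalSpace F E)] [∀ x, TopologicalSpace (E x)]
  [FiberBundle F E] [∀ x, AddCommGroup (E x)] [∀ x, Module 𝕜 (E x)] [VectorBundle 𝕜 F E]

/-- The extension of `e ∈ E x` to a local section around `x` which is constant in the preferred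
trivialization of `E` at `x`. -/
def ext {x : X} (e : E x) (y : X) : E y :=
  (trivializationAt F E x).symmL 𝕜 y ((trivializationAt F E x).continuousLinearMapAt 𝕜 x e)

theorem ext_self {x : X} (e : E x) : ext 𝕜 F e x = e :=
  (trivializationAt F E x).symmL_continuousLinearMapAt
    (FiberBundle.mem_baseSet_trivializationAt' x) e

theorem ext_add {x : X} (e e' : E x) : ext 𝕜 F (e + e') = ext 𝕜 F e + ext 𝕜 F e' := by
  funext y
  simp [ext]

theorem ext_smul {x : X} (c : 𝕜) (e : E x) : ext 𝕜 F (c • e) = c • ext 𝕜 F e := by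
  funext y
  simp [ext]

theorem ext_coord {x : X} (e : E x) :
    (fun y ↦ (trivializationAt F E x (TotalSpace.mk' F y (ext 𝕜 F e y))).2) =ᶠ[𝓝 x]
      fun _ ↦ (trivializationAt F E x (TotalSpace.mk' F x e)).2 := by
  have hx := FiberBundle.mem_baseSet_trivializationAt' (F := F) (E := E) x
  filter_upwards [(trivializationAt F E x).open_baseSet.mem_nhds hx] with y hy
  rw [← (trivializationAt F E x).continuousLinearMapAt_apply_of_mem 𝕜 hy,
    ← (trivializationAt F E x).continuousLinearMapAt_apply_of_mem 𝕜 hx, ext,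
    Trivialization.continuousLinearMapAt_symmL _ hy]

end Extension


/-! ### Forms with values in the endomorphisms of a complex vector bundle -/

section Alg

/-- The alternating `2`-form attached to a bilinear map `B` with `B v v = 0`. -/
def altOfBilin {M N : Type*} [AddCommGroup M] [Module ℝ M] [AddCommGroup N] [Module ℝ N]
    (B : M →ₗ[ℝ] M →ₗ[ℝ] N) (hB : ∀ v, B v v = 0) : M [⋀^Fin 2]→ₗ[ℝ] N where
  toFun v := B (v 0) (v 1)
  map_update_add' v i a b := by fin_cases i <;> simp [Function.update]
  map_update_smul' v i a b := by fin_cases i <;> simp [Function.update]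
  map_eq_zero_of_eq' v i j hij hne := by
    have h01 : v 0 = v 1 := by
      fin_cases i <;> fin_cases j <;> simp_all
    simp [h01, hB]

/-- The bilinear map underlying an alternating `2`-form. -/
def bilin {M N : Type*} [AddCommGroup M] [Module ℝ M] [AddCommGroup N] [Module ℝ N]
    (B : M [⋀^Fin 2]→ₗ[ℝ] N) : M →ₗ[ℝ] M →ₗ[ℝ] N :=
  LinearMap.mk₂ ℝ (fun u v ↦ B ![u, v])
    (fun u u' v ↦ B.map_vecCons_add ![v] u u') (fun c u v ↦ B.map_vecCons_smul ![v] c u)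
    (fun u v v' ↦ (B.curryLeft u).map_vecCons_add ![] v v')
    (fun c u v ↦ (B.curryLeft u).map_vecCons_smul ![] c v)

theorem altOfBilin_apply {M N : Type*} [AddCommGroup M] [Module ℝ M] [AddCommGroup N] [Module ℝ N]
    (B : M →ₗ[ℝ] M →ₗ[ℝ] N) (hB : ∀ v, B v v = 0) (v : Fin 2 → M) :
    altOfBilin B hB v = B (v 0) (v 1) := rfl

theorem apply_eq_bilin {M N : Type*} [AddCommGroup M] [Module ℝ M] [AddCommGroup N] [Module ℝ N]
    (B : M [⋀^Fin 2]→ₗ[ℝ] N) (v : Fin 2 → M) : B v = bilin B (v 0) (v 1) := by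
  have h : v = ![v 0, v 1] := by
    funext i
    fin_cases i <;> rfl
  exact congrArg B h

theorem bilin_apply {M N : Type*} [AddCommGroup M] [Module ℝ M] [AddCommGroup N] [Module ℝ N]
    (B : M [⋀^Fin 2]→ₗ[ℝ] N) (u v : M) : bilin B u v = B ![u, v] := rfl

theorem bilin_self {M N : Type*} [AddCommGroup M] [Module ℝ M] [AddCommGroup N] [Module ℝ N]
    (B : M [⋀^Fin 2]→ₗ[ℝ] N) (u : M) : bilin B u u = 0 :=
  B.map_eq_zero_of_eq ![u, u] (i := 0) (j := 1) rfl (by decide)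

theorem bilin_swap {M N : Type*} [AddCommGroup M] [Module ℝ M] [AddCommGroup N] [Module ℝ N]
    (B : M [⋀^Fin 2]→ₗ[ℝ] N) (u v : M) : bilin B v u = - bilin B u v := by
  have h := bilin_self B (u + v)
  simp only [map_add, LinearMap.add_apply, bilin_self, zero_add, add_zero] at h
  exact eq_neg_of_add_eq_zero_left h

end Alg

section Forms

variable (V : Type*) [NormedAddCommGroup V] [NormedSpace ℂ V]
  {X : Type*} [TopologicalSpace X] [ChartedSpace V X]
  (F : Type*) [NormedAddCommGroup F] [NormedSpace ℂ F]
  (E : X → Type*) [∀ x, AddCommGroup (E x)] [∀ x, Module ℂ (E x)]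

/-- Complex `1`-forms on `X` with values in `End E`: since `End E` is complex, a complex-linear
form on the complexified tangent space is the same as a real-linear form on the tangent space. -/
abbrev OneForm : Type _ := ∀ x : X, TangentSpace 𝓘(ℝ, V) x →ₗ[ℝ] Module.End ℂ (E x)

/-- Complex `2`-forms on `X` with values in `End E`. -/
abbrev TwoForm : Type _ := ∀ x : X, TangentSpace 𝓘(ℝ, V) x [⋀^Fin 2]→ₗ[ℝ] Module.End ℂ (E x)

variable {V E}

/-- The wedge product: `(Φ ∧ Ψ)(u, v) = Φ(u) Ψ(v) - Φ(v) Ψ(u)`. -/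
def wedge (Φ Ψ : OneForm V E) : TwoForm V E := fun x ↦
  altOfBilin (LinearMap.mk₂ ℝ (fun u v ↦ Φ x u * Ψ x v - Φ x v * Ψ x u)
    (by intros; simp; noncomm_ring) (by intros; simp [smul_sub])
    (by intros; simp; noncomm_ring) (by intros; simp [smul_sub])) (by intros; simp)

/-- The commutator `[Φ, Ψ] = Φ ∧ Ψ - (-1)^{1·1} Ψ ∧ Φ` of two `1`-forms. -/
def bracket (Φ Ψ : OneForm V E) : TwoForm V E := wedge Φ Ψ - (-1 : ℂ) ^ (1 * 1) • wedge Ψ Φ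

/-- A `2`-form is of type `(p, q)`, where `p + q = 2`, if it is homogeneous of bidegree `(p, q)`. -/
def TwoForm.IsType (p q : ℕ) (B : TwoForm V E) : Prop :=
  ∀ (x : X) (c : ℂ) (v : Fin 2 → TangentSpace 𝓘(ℝ, V) x),
    B x (fun i ↦ scal c x (v i)) = (c ^ p * conj c ^ q) • B x v

/-- The component of type `(2, 0)` of a `2`-form. -/
def TwoForm.part20 (B : TwoForm V E) : TwoForm V E := fun x ↦
  altOfBilin (LinearMap.mk₂ ℝ
    (fun u v ↦ (1 / 4 : ℂ) • (bilin (B x) u v - bilin (B x) (cplx x u) (cplx x v)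
      - Complex.I • (bilin (B x) (cplx x u) v + bilin (B x) u (cplx x v))))
    (by intros; simp only [map_add, LinearMap.add_apply]; module)
    (by intros; simp only [map_smul, LinearMap.smul_apply]; module)
    (by intros; simp only [map_add]; module)
    (by intros; simp only [map_smul]; module))
    (by
      intro v
      simp only [LinearMap.mk₂_apply, bilin_self, bilin_swap (B x) v (cplx x v)]
      simp)

/-- The component of type `(1, 1)` of a `2`-form. -/
def TwoForm.part11 (B : TwoForm V E) : TwoForm V E := fun x ↦
  altOfBilin (LinearMap.mk₂ ℝ
    (fun u v ↦ (1 / 2 : ℂ) • (bilin (B x) u v + bilin (B x) (cplx x u) (cplx x v)))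
    (by intros; simp only [map_add, LinearMap.add_apply]; module)
    (by intros; simp only [map_smul, LinearMap.smul_apply]; module)
    (by intros; simp only [map_add]; module)
    (by intros; simp only [map_smul]; module))
    (by intro v; simp [bilin_self])

/-- The component of type `(0, 2)` of a `2`-form. -/
def TwoForm.part02 (B : TwoForm V E) : TwoForm V E := fun x ↦
  altOfBilin (LinearMap.mk₂ ℝ
    (fun u v ↦ (1 / 4 : ℂ) • (bilin (B x) u v - bilin (B x) (cplx x u) (cplx x v)
      + Complex.I • (bilin (B x) (cplx x u) v + bilin (B x) u (cplx x v))))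
    (by intros; simp only [map_add, LinearMap.add_apply]; module)
    (by intros; simp only [map_smul, LinearMap.smul_apply]; module)
    (by intros; simp only [map_add]; module)
    (by intros; simp only [map_smul]; module))
    (by
      intro v
      simp only [LinearMap.mk₂_apply, bilin_self, bilin_swap (B x) v (cplx x v)]
      simp)

theorem TwoForm.part_add (B : TwoForm V E) : B.part20 + B.part11 + B.part02 = B := by
  funext x
  ext1 v
  rw [apply_eq_bilin (B x) v]
  simp only [Pi.add_apply, AlternatingMap.add_apply, TwoForm.part20, TwoForm.part11,
    TwoForm.part02, altOfBilin_apply, LinearMap.mk₂_apply]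
  module

theorem scal_eq (c : ℂ) (x : X) (v : TangentSpace 𝓘(ℝ, V) x) :
    scal c x v = c.re • v + c.im • cplx x v := by
  change c • (show V from v) = c.re • (show V from v) + c.im • (Complex.I • (show V from v))
  conv_lhs => rw [← Complex.re_add_im c]
  rw [add_smul, mul_smul, Complex.coe_smul, Complex.coe_smul]

theorem cplx_cplx (x : X) (v : TangentSpace 𝓘(ℝ, V) x) : cplx x (cplx x v) = -v := by
  change Complex.I • (Complex.I • (show V from v)) = -(show V from v)
  rw [smul_smul, Complex.I_mul_I, neg_one_smul]

theorem TwoForm.isType_part20 (B : TwoForm V E) : B.part20.IsType 2 0 := by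
  intro x c v
  simp only [TwoForm.part20, altOfBilin_apply, LinearMap.mk₂_apply, scal_eq, map_add, map_smul,
    cplx_cplx, LinearMap.add_apply, LinearMap.smul_apply, LinearMap.neg_apply, map_neg]
  have hc : c ^ 2 * conj c ^ 0 =
    ((c.re ^ 2 - c.im ^ 2 : ℝ) : ℂ) + ((2 * c.re * c.im : ℝ) : ℂ) * Complex.I := by
    apply Complex.ext <;> simp [pow_two]
    all_goals ring
  rw [hc]
  generalize c.re = a
  generalize c.im = b
  match_scalars <;> ring_nf <;> simp [Complex.I_sq] <;> ring

theorem TwoForm.isType_part11 (B : TwoForm V E) : B.part11.IsType 1 1 := by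
  intro x c v
  simp only [TwoForm.part11, altOfBilin_apply, LinearMap.mk₂_apply, scal_eq, map_add, map_smul,
    cplx_cplx, LinearMap.add_apply, LinearMap.smul_apply, LinearMap.neg_apply, map_neg]
  have hc : c ^ 1 * conj c ^ 1 = ((c.re ^ 2 + c.im ^ 2 : ℝ) : ℂ) := by
    apply Complex.ext <;> simp [pow_two]
    all_goals ring
  rw [hc]
  generalize c.re = a
  generalize c.im = b
  module

theorem TwoForm.isType_part02 (B : TwoForm V E) : B.part02.IsType 0 2 := by
  intro x c v
  simp only [TwoForm.part02, altOfBilin_apply, LinearMap.mk₂_apply, scal_eq, map_add, map_smul,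
    cplx_cplx, LinearMap.add_apply, LinearMap.smul_apply, LinearMap.neg_apply, map_neg]
  have hc : c ^ 0 * conj c ^ 2 =
    ((c.re ^ 2 - c.im ^ 2 : ℝ) : ℂ) - ((2 * c.re * c.im : ℝ) : ℂ) * Complex.I := by
    apply Complex.ext <;> simp [pow_two]
    all_goals ring
  rw [hc]
  generalize c.re = a
  generalize c.im = b
  match_scalars <;> ring_nf <;> simp [Complex.I_sq] <;> ring

variable [IsManifold 𝓘(ℂ, V) ω X]
  [TopologicalSpace (TotalSpace F E)] [∀ x, TopologicalSpace (E x)] [FiberBundle F E]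

/-- The form `Φ` is `C^∞`: for local smooth vector fields `W` and sections `s`, so is `Φ(W) s`. -/
def OneForm.IsSmooth (Φ : OneForm V E) : Prop :=
  ∀ (x : X) (W : ∀ y : X, TangentSpace 𝓘(ℝ, V) y) (s : ∀ y, E y),
    SmoothAt V V W x → SmoothAt V F s x → SmoothAt V F (fun y ↦ Φ y (W y) (s y)) x

variable (V E) in
/-- The space `A^{1,0}(End E)` of `C^∞` forms of type `(1, 0)` with values in `End E`. -/
structure OneZeroForm where
  toForm : OneForm V E
  type10 : ∀ (x : X) (v : TangentSpace 𝓘(ℝ, V) x),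
    toForm x (cplx x v) = Complex.I • toForm x v
  smooth : OneForm.IsSmooth F toForm

variable {F}

instance [VectorBundle ℂ F E] : SMul ℂ (OneZeroForm V F E) where
  smul c Φ :=
    { toForm := c • Φ.toForm
      type10 := fun x v ↦ by
        simp only [Pi.smul_apply, LinearMap.smul_apply, Φ.type10]
        rw [smul_comm]
      smooth := fun x W s hW hs ↦ (Φ.smooth x W s hW hs).smul c }

/-- A Higgs field: a holomorphic form of type `(1, 0)` with values in `End E` such that
`Φ ∧ Φ = 0`. Holomorphic means that `Φ(W) s` is a holomorphic section for all local holomorphic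
vector fields `W` and local holomorphic sections `s`. -/
structure IsHiggsField (Φ : OneZeroForm V F E) : Prop where
  holomorphic : ∀ (x : X) (W : ∀ y : X, TangentSpace 𝓘(ℂ, V) y) (s : ∀ y, E y),
    HolomorphicAt V V W x → HolomorphicAt V F s x →
      HolomorphicAt V F (fun y ↦ Φ.toForm y (W y : V) (s y)) x
  wedge_self : wedge Φ.toForm Φ.toForm = 0

end Forms

/-! ### Hermitian metrics and hermitian conjugation -/

section Metric

variable (V : Type*) [NormedAddCommGroup V] [NormedSpace ℂ V]
  {X : Type*} [TopologicalSpace X] [ChartedSpace V X]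
  (F : Type*) [NormedAddCommGroup F] [NormedSpace ℂ F]
  (E : X → Type*) [∀ x, AddCommGroup (E x)] [∀ x, Module ℂ (E x)]
  [TopologicalSpace (TotalSpace F E)] [∀ x, TopologicalSpace (E x)] [FiberBundle F E]

/-- A hermitian metric in `E`: a `C^∞` field of hermitian inner products on the fibers, linear in
the first and conjugate-linear in the second argument. -/
structure HermitianMetric where
  form : ∀ x, E x →ₗ[ℂ] E x →ₗ⋆[ℂ] ℂ
  conj_symm : ∀ x v w, conj (form x w v) = form x v w
  pos : ∀ x v, v ≠ 0 → 0 < (form x v v).re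
  smooth : ∀ (x : X) (s t : ∀ y, E y), SmoothAt V F s x → SmoothAt V F t x →
    ContMDiffAt 𝓘(ℝ, V) 𝓘(ℝ, ℂ) ∞ (fun y ↦ form y (s y) (t y)) x

variable {V F E}

theorem finiteDimensional_fiber [VectorBundle ℂ F E] [FiniteDimensional ℂ F] (x : X) :
    FiniteDimensional ℂ (E x) :=
  ((trivializationAt F E x).linearEquivAt ℂ x
    (FiberBundle.mem_baseSet_trivializationAt' x)).symm.finiteDimensional

/-- The inner product space structure on the fiber `E x` with `⟪v, w⟫ = h(w, v)`. -/
@[reducible]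
def HermitianMetric.core (h : HermitianMetric V F E) (x : X) : InnerProductSpace.Core ℂ (E x) where
  inner v w := h.form x w v
  conj_inner_symm v w := h.conj_symm x w v
  re_inner_nonneg v := by
    by_cases hv : v = 0
    · simp [hv]
    · exact (h.pos x v hv).le
  add_left u v w := by simp
  smul_left u v c := by simp
  definite v hv := by
    by_contra hne
    have := h.pos x v hne
    simp [hv] at this

/-- The adjoint of an endomorphism of the fiber `E x` with respect to `h`. -/
def HermitianMetric.adjoint [VectorBundle ℂ F E] [FiniteDimensional ℂ F]
    (h : HermitianMetric V F E) (x : X) (A : Module.End ℂ (E x)) : Module.End ℂ (E x) :=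
  letI : NormedAddCommGroup (E x) := (h.core x).toNormedAddCommGroup
  letI : InnerProductSpace ℂ (E x) := InnerProductSpace.ofCore (h.core x).toCore
  haveI : FiniteDimensional ℂ (E x) := finiteDimensional_fiber (F := F) x
  LinearMap.adjoint A

theorem HermitianMetric.adjoint_spec [VectorBundle ℂ F E] [FiniteDimensional ℂ F]
    (h : HermitianMetric V F E) (x : X) (A : Module.End ℂ (E x)) (v w : E x) :
    h.form x (h.adjoint x A v) w = h.form x v (A w) := by
  let : NormedAddCommGroup (E x) := (h.core x).toNormedAddCommGroup
  let : InnerProductSpace ℂ (E x) := InnerProductSpace.ofCore (h.core x).toCore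
  have : FiniteDimensional ℂ (E x) := finiteDimensional_fiber (F := F) x
  exact LinearMap.adjoint_inner_right A w v

/-- The hermitian conjugate `Φ̄_h` of an `End E`-valued `1`-form, given by
`h(Φ̄_h s, s') = h(s, Φ s')`. On a real tangent vector `v` this says that
`Φ̄_h(v)` is the adjoint of `Φ(v)`. -/
def HermitianMetric.conjForm [VectorBundle ℂ F E] [FiniteDimensional ℂ F]
    (h : HermitianMetric V F E) (Φ : OneForm V E) : OneForm V E := fun x ↦
  { toFun := fun v ↦ h.adjoint x (Φ x v)
    map_add' := fun u v ↦ by rw [map_add]; exact map_add _ _ _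
    map_smul' := fun c v ↦ by
      rw [map_smul, ← Complex.coe_smul, HermitianMetric.adjoint, LinearEquiv.map_smulₛₗ,
        Complex.conj_ofReal, Complex.coe_smul]
      rfl }

end Metric

/-! ### Connections -/

section Connection

variable (V : Type*) [NormedAddCommGroup V] [NormedSpace ℂ V]
  {X : Type*} [TopologicalSpace X] [ChartedSpace V X] [IsManifold 𝓘(ℂ, V) ω X]
  (F : Type*) [NormedAddCommGroup F] [NormedSpace ℂ F]
  (E : X → Type*) [∀ x, AddCommGroup (E x)] [∀ x, Module ℂ (E x)]
  [TopologicalSpace (TotalSpace F E)] [∀ x, TopologicalSpace (E x)]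
  [∀ x, IsTopologicalAddGroup (E x)] [∀ x, ContinuousSMul ℂ (E x)] [FiberBundle F E]

/-- A (smooth, complex-linear) connection `D` on the complex vector bundle `E`: a covariant
derivative along real tangent vectors, commuting with multiplication by `i`, such that `D_W s` is
`C^∞` wherever the vector field `W` and the section `s` are. -/
structure Connection extends CovariantDerivative 𝓘(ℝ, V) F E where
  map_I_smul : ∀ (x : X) (s : ∀ y, E y), DiffAt V F s x → ∀ v : TangentSpace 𝓘(ℝ, V) x,
    toFun (fun y ↦ Complex.I • s y) x v = Complex.I • toFun s x v
  smooth : ∀ (x : X) (W : ∀ y : X, TangentSpace 𝓘(ℝ, V) y) (s : ∀ y, E y),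
    SmoothAt V V W x → SmoothAt V F s x → SmoothAt V F (fun y ↦ toFun s y (W y)) x

variable {V F E}

namespace Connection

variable (D : Connection V F E)

theorem map_add {x : X} {s t : ∀ y, E y} (hs : DiffAt V F s x) (ht : DiffAt V F t x) :
    D.toFun (s + t) x = D.toFun s x + D.toFun t x :=
  D.isCovariantDerivativeOnUniv.add hs ht

theorem map_smul_real {x : X} {s : ∀ y, E y} (c : ℝ) (hs : DiffAt V F s x) :
    D.toFun (c • s) x = c • D.toFun s x :=
  D.isCovariantDerivativeOnUniv.smul_const c hs

/-- The part `D''` of type `(0, 1)` of the connection: `D''_v s = (D_v s + i D_{iv} s) / 2`. -/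
def antihol (s : ∀ y, E y) (x : X) (v : TangentSpace 𝓘(ℝ, V) x) : E x :=
  (1 / 2 : ℂ) • (D.toFun s x v + Complex.I • D.toFun s x (cplx x v))

theorem congr {x : X} {s t : ∀ y, E y} (hs : DiffAt V F s x) (ht : DiffAt V F t x)
    (hst : ∀ᶠ y in 𝓝 x, s y = t y) : D.toFun s x = D.toFun t x :=
  D.isCovariantDerivativeOnUniv.congr_of_eventuallyEq hs ht Filter.univ_mem hst

variable [VectorBundle ℂ F E]

theorem map_smul {x : X} {s : ∀ y, E y} (c : ℂ) (hs : DiffAt V F s x)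
    (v : TangentSpace 𝓘(ℝ, V) x) :
    D.toFun (fun y ↦ c • s y) x v = c • D.toFun s x v := by
  have h : (fun y ↦ c • s y) = (c.re • s) + (c.im • (fun y ↦ Complex.I • s y)) := by
    funext y
    simp only [Pi.add_apply, Pi.smul_apply]
    conv_lhs => rw [← Complex.re_add_im c]
    rw [add_smul, mul_smul, Complex.coe_smul, Complex.coe_smul]
  have h1 : DiffAt V F (c.re • s) x := hs.smul (c.re : ℂ)
  have h2 : DiffAt V F (fun y ↦ Complex.I • s y) x := hs.smul Complex.I
  have h3 : DiffAt V F (c.im • (fun y ↦ Complex.I • s y)) x :=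
    (hs.smul Complex.I).smul (c.im : ℂ)
  rw [h, D.map_add h1 h3, D.map_smul_real _ hs, D.map_smul_real _ h2]
  simp only [add_apply, smul_apply,
    D.map_I_smul x s hs]
  conv_rhs => rw [← Complex.re_add_im c]
  rw [add_smul, mul_smul, Complex.coe_smul, Complex.coe_smul]

theorem smoothAt_ext {x : X} (e : E x) : SmoothAt V F (ext ℂ F e) x := by
  unfold SmoothAt
  rw [contMDiffAt_section]
  exact contMDiffAt_const.congr_of_eventuallyEq (ext_coord ℂ F e)

theorem smoothAt_extTangent {x : X} (v : TangentSpace 𝓘(ℝ, V) x) :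
    SmoothAt V V (ext ℝ V v) x := by
  unfold SmoothAt
  rw [contMDiffAt_section]
  exact contMDiffAt_const.congr_of_eventuallyEq (ext_coord ℝ V v)

/-- `D_U D_W s - D_W D_U s - D_{[U, W]} s` at the point `x`. -/
def curvatureOn (U W : ∀ y : X, TangentSpace 𝓘(ℝ, V) y) (s : ∀ y, E y) (x : X) : E x :=
  D.toFun (fun y ↦ D.toFun s y (W y)) x (U x) - D.toFun (fun y ↦ D.toFun s y (U y)) x (W x)
    - D.toFun s x (VectorField.mlieBracket 𝓘(ℝ, V) U W x)

/-- `D_U (Φ(W) s) - Φ(W) D_U s - D_W (Φ(U) s) + Φ(U) D_W s - Φ([U, W]) s` at the point `x`. -/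
def extDerivOn (Φ : OneForm V E) (U W : ∀ y : X, TangentSpace 𝓘(ℝ, V) y) (s : ∀ y, E y) (x : X) :
    E x :=
  (D.toFun (fun y ↦ Φ y (W y) (s y)) x (U x) - Φ x (W x) (D.toFun s x (U x)))
    - (D.toFun (fun y ↦ Φ y (U y) (s y)) x (W x) - Φ x (U x) (D.toFun s x (W x)))
    - Φ x (VectorField.mlieBracket 𝓘(ℝ, V) U W x) (s x)

section tens

variable {D} {x : X} {U U' W : ∀ y : X, TangentSpace 𝓘(ℝ, V) y} {s s' : ∀ y, E y}

theorem curvatureOn_swap : D.curvatureOn W U s x = - D.curvatureOn U W s x := by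
  simp only [curvatureOn, VectorField.mlieBracket_swap_apply (V := W) (W := U), _root_.map_neg]
  abel

theorem curvatureOn_self : D.curvatureOn U U s x = 0 := by
  simp [curvatureOn]

theorem curvatureOn_add [FiniteDimensional ℂ V] (hU : SmoothAt V V U x) (hU' : SmoothAt V V U' x)
    (hs : SmoothAt V F s x) :
    D.curvatureOn (U + U') W s x = D.curvatureOn U W s x + D.curvatureOn U' W s x := by
  have : CompleteSpace V := FiniteDimensional.complete ℂ V
  have h : D.toFun (fun y ↦ D.toFun s y ((U + U') y)) x =
      D.toFun (fun y ↦ D.toFun s y (U y)) x + D.toFun (fun y ↦ D.toFun s y (U' y)) x := by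
    rw [← D.map_add (D.smooth x U s hU hs).diffAt (D.smooth x U' s hU' hs).diffAt]
    congr 1
    funext y
    simp
  rw [curvatureOn, h, VectorField.mlieBracket_add_left hU.diffAt hU'.diffAt]
  simp only [curvatureOn, _root_.map_add, Pi.add_apply, add_apply]
  abel

theorem curvatureOn_smul [FiniteDimensional ℂ V] (c : ℝ) (hU : SmoothAt V V U x)
    (hs : SmoothAt V F s x) :
    D.curvatureOn (c • U) W s x = c • D.curvatureOn U W s x := by
  have : CompleteSpace V := FiniteDimensional.complete ℂ V
  have h : D.toFun (fun y ↦ D.toFun s y ((c • U) y)) x =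
      c • D.toFun (fun y ↦ D.toFun s y (U y)) x := by
    rw [← D.map_smul_real c (D.smooth x U s hU hs).diffAt]
    congr 1
    funext y
    simp
  rw [curvatureOn, h, VectorField.mlieBracket_const_smul_left hU.diffAt]
  simp only [curvatureOn, _root_.map_smul, Pi.smul_apply, smul_apply, smul_sub]

variable [ContMDiffVectorBundle ω F E 𝓘(ℂ, V)]

theorem toFun_toFun_add (hW : SmoothAt V V W x)
    (hs : SmoothAt V F s x) (hs' : SmoothAt V F s' x) :
    D.toFun (fun y ↦ D.toFun (s + s') y (W y)) x =
      D.toFun (fun y ↦ D.toFun s y (W y)) x + D.toFun (fun y ↦ D.toFun s' y (W y)) x := by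
  rw [← D.map_add (D.smooth x W s hW hs).diffAt (D.smooth x W s' hW hs').diffAt]
  refine D.congr (D.smooth x W _ hW (hs.add hs')).diffAt
    ((D.smooth x W s hW hs).add (D.smooth x W s' hW hs')).diffAt ?_
  filter_upwards [hs.eventually_diffAt, hs'.eventually_diffAt] with y hy hy'
  simp [D.map_add hy hy']

theorem toFun_toFun_smul (c : ℂ) (hW : SmoothAt V V W x) (hs : SmoothAt V F s x)
    (v : TangentSpace 𝓘(ℝ, V) x) :
    D.toFun (fun y ↦ D.toFun (fun y ↦ c • s y) y (W y)) x v =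
      c • D.toFun (fun y ↦ D.toFun s y (W y)) x v := by
  rw [← D.map_smul c (D.smooth x W s hW hs).diffAt]
  refine DFunLike.congr_fun (D.congr (D.smooth x W _ hW (hs.smul c)).diffAt
    ((D.smooth x W s hW hs).smul c).diffAt ?_) v
  filter_upwards [hs.eventually_diffAt] with y hy
  exact D.map_smul c hy _

theorem curvatureOn_add_section (hU : SmoothAt V V U x) (hW : SmoothAt V V W x)
    (hs : SmoothAt V F s x) (hs' : SmoothAt V F s' x) :
    D.curvatureOn U W (s + s') x = D.curvatureOn U W s x + D.curvatureOn U W s' x := by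
  rw [curvatureOn, toFun_toFun_add hW hs hs', toFun_toFun_add hU hs hs',
    D.map_add hs.diffAt hs'.diffAt]
  simp only [curvatureOn, add_apply]
  abel

theorem curvatureOn_smul_section (c : ℂ) (hU : SmoothAt V V U x) (hW : SmoothAt V V W x)
    (hs : SmoothAt V F s x) :
    D.curvatureOn U W (fun y ↦ c • s y) x = c • D.curvatureOn U W s x := by
  rw [curvatureOn, toFun_toFun_smul c hW hs, toFun_toFun_smul c hU hs, D.map_smul c hs.diffAt]
  simp only [curvatureOn, smul_sub]

variable {Φ : OneForm V E}

theorem extDerivOn_swap : D.extDerivOn Φ W U s x = - D.extDerivOn Φ U W s x := by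
  simp only [extDerivOn, VectorField.mlieBracket_swap_apply (V := W) (W := U), _root_.map_neg,
    LinearMap.neg_apply]
  abel

theorem extDerivOn_self : D.extDerivOn Φ U U s x = 0 := by
  simp [extDerivOn]

theorem extDerivOn_add [FiniteDimensional ℂ V] (hΦ : OneForm.IsSmooth F Φ)
    (hU : SmoothAt V V U x) (hU' : SmoothAt V V U' x)
    (hs : SmoothAt V F s x) :
    D.extDerivOn Φ (U + U') W s x = D.extDerivOn Φ U W s x + D.extDerivOn Φ U' W s x := by
  have : CompleteSpace V := FiniteDimensional.complete ℂ V
  have h : D.toFun (fun y ↦ Φ y ((U + U') y) (s y)) x =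
      D.toFun (fun y ↦ Φ y (U y) (s y)) x + D.toFun (fun y ↦ Φ y (U' y) (s y)) x := by
    rw [← D.map_add (hΦ x U s hU hs).diffAt (hΦ x U' s hU' hs).diffAt]
    congr 1
    funext y
    simp
  rw [extDerivOn, h, VectorField.mlieBracket_add_left hU.diffAt hU'.diffAt]
  simp only [extDerivOn, _root_.map_add, Pi.add_apply, add_apply, LinearMap.add_apply]
  abel

theorem extDerivOn_smul [FiniteDimensional ℂ V] (hΦ : OneForm.IsSmooth F Φ)
    (c : ℝ) (hU : SmoothAt V V U x)
    (hs : SmoothAt V F s x) :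
    D.extDerivOn Φ (c • U) W s x = c • D.extDerivOn Φ U W s x := by
  have : CompleteSpace V := FiniteDimensional.complete ℂ V
  have h : D.toFun (fun y ↦ Φ y ((c • U) y) (s y)) x =
      c • D.toFun (fun y ↦ Φ y (U y) (s y)) x := by
    rw [← D.map_smul_real c (hΦ x U s hU hs).diffAt]
    congr 1
    funext y
    simp
  rw [extDerivOn, h, VectorField.mlieBracket_const_smul_left hU.diffAt]
  simp only [extDerivOn, _root_.map_smul, Pi.smul_apply, smul_apply, LinearMap.smul_apply, smul_sub,
    LinearMap.map_smul_of_tower]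

theorem extDerivOn_add_section (hΦ : OneForm.IsSmooth F Φ)
    (hU : SmoothAt V V U x) (hW : SmoothAt V V W x)
    (hs : SmoothAt V F s x) (hs' : SmoothAt V F s' x) :
    D.extDerivOn Φ U W (s + s') x = D.extDerivOn Φ U W s x + D.extDerivOn Φ U W s' x := by
  have h (W : ∀ y : X, TangentSpace 𝓘(ℝ, V) y) (hW : SmoothAt V V W x) :
      D.toFun (fun y ↦ Φ y (W y) ((s + s') y)) x =
        D.toFun (fun y ↦ Φ y (W y) (s y)) x + D.toFun (fun y ↦ Φ y (W y) (s' y)) x := by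
    rw [← D.map_add (hΦ x W s hW hs).diffAt (hΦ x W s' hW hs').diffAt]
    congr 1
    funext y
    simp
  rw [extDerivOn, h U hU, h W hW, D.map_add hs.diffAt hs'.diffAt]
  simp only [extDerivOn, _root_.map_add, Pi.add_apply, add_apply]
  abel

theorem extDerivOn_smul_section (hΦ : OneForm.IsSmooth F Φ)
    (c : ℂ) (hU : SmoothAt V V U x) (hW : SmoothAt V V W x)
    (hs : SmoothAt V F s x) :
    D.extDerivOn Φ U W (fun y ↦ c • s y) x = c • D.extDerivOn Φ U W s x := by
  have h (W : ∀ y : X, TangentSpace 𝓘(ℝ, V) y) (hW : SmoothAt V V W x)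
      (v : TangentSpace 𝓘(ℝ, V) x) :
      D.toFun (fun y ↦ Φ y (W y) (c • s y)) x v = c • D.toFun (fun y ↦ Φ y (W y) (s y)) x v := by
    rw [← D.map_smul c (hΦ x W s hW hs).diffAt]
    congr 2
    funext y
    simp
  rw [extDerivOn, h U hU, h W hW, D.map_smul c hs.diffAt, D.map_smul c hs.diffAt]
  simp only [extDerivOn, _root_.map_smul, smul_sub]

end tens

variable [ContMDiffVectorBundle ω F E 𝓘(ℂ, V)] [FiniteDimensional ℂ V]

/-- The curvature `F = D ∧ D` of a connection, as an `End E`-valued `2`-form: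
`F(u, v) e = (D_U D_W s - D_W D_U s - D_{[U, W]} s)(x)`, where `U`, `W`, `s` are smooth extensions
of `u`, `v`, `e`. The right hand side is tensorial, so that any smooth extension may be used; we
take those that are constant in the preferred trivializations. -/
def curvature : TwoForm V E := fun x ↦
  altOfBilin (LinearMap.mk₂ ℝ
    (fun u v ↦
      { toFun := fun e ↦ D.curvatureOn (ext ℝ V u) (ext ℝ V v) (ext ℂ F e) x
        map_add' := fun e e' ↦ by
          rw [ext_add]
          exact curvatureOn_add_section (smoothAt_extTangent u) (smoothAt_extTangent v)
            (smoothAt_ext e) (smoothAt_ext e')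
        map_smul' := fun c e ↦ by
          rw [ext_smul]
          exact curvatureOn_smul_section c (smoothAt_extTangent u) (smoothAt_extTangent v)
            (smoothAt_ext e) })
    (fun u u' v ↦ by
      ext e
      simp only [LinearMap.coe_mk, AddHom.coe_mk, LinearMap.add_apply, ext_add]
      exact curvatureOn_add (smoothAt_extTangent u) (smoothAt_extTangent u') (smoothAt_ext e))
    (fun c u v ↦ by
      ext e
      simp only [LinearMap.coe_mk, AddHom.coe_mk, LinearMap.smul_apply, ext_smul]
      exact curvatureOn_smul c (smoothAt_extTangent u) (smoothAt_ext e))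
    (fun u v v' ↦ by
      ext e
      simp only [LinearMap.coe_mk, AddHom.coe_mk, LinearMap.add_apply, ext_add]
      rw [curvatureOn_swap, curvatureOn_add (smoothAt_extTangent v) (smoothAt_extTangent v')
        (smoothAt_ext e), curvatureOn_swap (U := ext ℝ V u), curvatureOn_swap (U := ext ℝ V u)]
      abel)
    (fun c u v ↦ by
      ext e
      simp only [LinearMap.coe_mk, AddHom.coe_mk, LinearMap.smul_apply, ext_smul]
      rw [curvatureOn_swap, curvatureOn_smul c (smoothAt_extTangent v) (smoothAt_ext e),
        curvatureOn_swap (U := ext ℝ V u), smul_neg, neg_neg]))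
    (fun u ↦ by
      ext e
      exact curvatureOn_self)

/-- The exterior covariant derivative `D Φ` of `Φ ∈ A^{1,0}(End E)`, for the connection
`(D_U A) s = D_U (A s) - A (D_U s)` induced on `End E`:
`(D Φ)(u, v) = (D_U (Φ(W)) - D_W (Φ(U)) - Φ([U, W]))(x)`, where `U`, `W` are smooth extensions of
`u`, `v`. The right hand side is tensorial, so that any smooth extension may be used; we take those
that are constant in the preferred trivializations. -/
def extDeriv (Φ : OneZeroForm V F E) : TwoForm V E := fun x ↦
  altOfBilin (LinearMap.mk₂ ℝ
    (fun u v ↦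
      { toFun := fun e ↦ D.extDerivOn Φ.toForm (ext ℝ V u) (ext ℝ V v) (ext ℂ F e) x
        map_add' := fun e e' ↦ by
          rw [ext_add]
          exact extDerivOn_add_section Φ.smooth (smoothAt_extTangent u) (smoothAt_extTangent v)
            (smoothAt_ext e) (smoothAt_ext e')
        map_smul' := fun c e ↦ by
          rw [ext_smul]
          exact extDerivOn_smul_section Φ.smooth c (smoothAt_extTangent u) (smoothAt_extTangent v)
            (smoothAt_ext e) })
    (fun u u' v ↦ by
      ext e
      simp only [LinearMap.coe_mk, AddHom.coe_mk, LinearMap.add_apply, ext_add]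
      exact extDerivOn_add Φ.smooth (smoothAt_extTangent u) (smoothAt_extTangent u')
        (smoothAt_ext e))
    (fun c u v ↦ by
      ext e
      simp only [LinearMap.coe_mk, AddHom.coe_mk, LinearMap.smul_apply, ext_smul]
      exact extDerivOn_smul Φ.smooth c (smoothAt_extTangent u) (smoothAt_ext e))
    (fun u v v' ↦ by
      ext e
      simp only [LinearMap.coe_mk, AddHom.coe_mk, LinearMap.add_apply, ext_add]
      rw [extDerivOn_swap, extDerivOn_add Φ.smooth (smoothAt_extTangent v)
        (smoothAt_extTangent v') (smoothAt_ext e), extDerivOn_swap (U := ext ℝ V u),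
        extDerivOn_swap (U := ext ℝ V u)]
      abel)
    (fun c u v ↦ by
      ext e
      simp only [LinearMap.coe_mk, AddHom.coe_mk, LinearMap.smul_apply, ext_smul]
      rw [extDerivOn_swap, extDerivOn_smul Φ.smooth c (smoothAt_extTangent v) (smoothAt_ext e),
        extDerivOn_swap (U := ext ℝ V u), smul_neg, neg_neg]))
    (fun u ↦ by
      ext e
      exact extDerivOn_self)

/-- `D' Φ ∈ A^{2,0}(End E)` for `Φ ∈ A^{1,0}(End E)`. -/
def delPrime (Φ : OneZeroForm V F E) : TwoForm V E := (D.extDeriv Φ).part20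

/-- `D'' Φ ∈ A^{1,1}(End E)` for `Φ ∈ A^{1,0}(End E)`. -/
def delDoublePrime (Φ : OneZeroForm V F E) : TwoForm V E := (D.extDeriv Φ).part11


end Connection


/-- The operator `d''` on sections of the holomorphic bundle `E`: `∂̄` applied to the coefficients of
`s` in a holomorphic trivialization, where `(∂̄ f)(v) = (df(v) + i df(i v)) / 2`. -/
def dbar [VectorBundle ℂ F E] (s : ∀ y, E y) (x : X) (v : TangentSpace 𝓘(ℝ, V) x) : E x :=
  let f : X → F := fun y ↦ (trivializationAt F E x (TotalSpace.mk' F y (s y))).2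
  (trivializationAt F E x).symmL ℂ x
    ((1 / 2 : ℂ) • (mvfderiv 𝓘(ℝ, V) f x v + Complex.I • mvfderiv 𝓘(ℝ, V) f x (cplx x v)))

/-- `D` is the Chern connection of the hermitian metric `h`: `D'' = d''` and
`d h(s, t) = h(D s, t) + h(s, D t)`. -/
structure IsChernConnection [VectorBundle ℂ F E] (D : Connection V F E)
    (h : HermitianMetric V F E) : Prop where
  antihol_eq : ∀ (x : X) (s : ∀ y, E y), DiffAt V F s x → ∀ v, D.antihol s x v = dbar (F := F) s x v
  metric : ∀ (x : X) (s t : ∀ y, E y), DiffAt V F s x → DiffAt V F t x →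
    ∀ v : TangentSpace 𝓘(ℝ, V) x, mvfderiv 𝓘(ℝ, V) (fun y ↦ h.form y (s y) (t y)) x v =
      h.form x (D.toFun s x v) (t x) + h.form x (s x) (D.toFun t x v)

section Equations

variable [VectorBundle ℂ F E] [ContMDiffVectorBundle ω F E 𝓘(ℂ, V)]
  [FiniteDimensional ℂ V] [FiniteDimensional ℂ F]

/-- Ward's `2k`-Hitchin equations for a connection `D`, a hermitian metric `h` and a form
`Φ ∈ A^{1,0}(End E)`. -/
structure WardEquations (D : Connection V F E) (h : HermitianMetric V F E)
    (Φ : OneZeroForm V F E) : Prop where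
  parallel : D.extDeriv Φ = 0
  curvature : D.curvature.part11 + (1 / 4 : ℂ) • bracket Φ.toForm (h.conjForm Φ.toForm) = 0
  commute : bracket Φ.toForm Φ.toForm = 0
  curvature20 : D.curvature.part20 = 0

/-- The reduced system `D' Φ = 0`, `F + [Φ, Φ̄_h] = 0`. -/
structure ReducedEquations (D : Connection V F E) (h : HermitianMetric V F E)
    (Φ : OneZeroForm V F E) : Prop where
  parallel : D.delPrime Φ = 0
  curvature : D.curvature + bracket Φ.toForm (h.conjForm Φ.toForm) = 0

end Equations

end Connection


end HiggsBundle

end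

/-!
The Chern connection is `D_v s = D'_v s + d''_v s`. Metric compatibility forces
`h(D'_v s, t) = ∂_v h(s, t) - h(s, d''_v t)` for all sections `t`, so in a holomorphic frame `σ` the
vector `D'_v s` solves the linear system `h(D'_v s, σ_i) = ∂_v h(s, σ_i)`, whose matrix is the Gram
matrix of `σ`. This defines `D'` pointwise (`HermitianMetric.chern10`); as the solution does not
depend on the frame (`HermitianMetric.form_chern10_frame`), it can be computed near a point in one
fixed frame, where Cramer's rule shows that it is smooth.

The curvature is evaluated on coordinate vector fields, which commute, and on a section that is
constant in a holomorphic trivialization. There `D_{iW} s = i D_W s`, which gives `F^{0,2} = 0`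
(`IsChernConnection.curvature02`). Differentiating `h(s, t)` twice shows that `F(u, v)` is
skew-hermitian (`IsChernConnection.curvature_skew`), and taking adjoints in `F^{0,2} = 0` yields
`F(iu, iv) = F(u, v)`, which means that `F` is of type `(1,1)`.

For a Higgs field `Φ`, holomorphic vector fields and sections turn every covariant derivative in
`(D Φ)(u, v)` into one of a holomorphic section; hence `D Φ` is complex bilinear, that is, of type
`(2,0)` (`IsChernConnection.extDeriv_cplx`). The equivalence of the two systems of equations is then
a rescaling, since `[Φ, Φ̄_h]` is homogeneous of degree `c c̄` under `Φ ↦ c Φ`.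
-/

open Bundle
open scoped Manifold ContDiff Topology ComplexConjugate

noncomputable section

namespace HiggsBundle

/-! ### Differential calculus on a complex manifold -/

section Calculus

variable {V : Type*} [NormedAddCommGroup V] [NormedSpace ℂ V]
  {X : Type*} [TopologicalSpace X] [ChartedSpace V X]
  {G : Type*} [NormedAddCommGroup G] [NormedSpace ℂ G]

/-- A holomorphic function has a complex linear differential. -/
theorem mvfderiv_cplx_of_holomorphic {f : X → G} {x : X}
    (hf : MDifferentiableAt 𝓘(ℂ, V) 𝓘(ℂ, G) f x) (v : TangentSpace 𝓘(ℝ, V) x) :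
    mvfderiv 𝓘(ℝ, V) f x (cplx x v) = Complex.I • mvfderiv 𝓘(ℝ, V) f x v := by
  have h1 := hf.hasMFDerivAt
  have h2 : HasMFDerivAt 𝓘(ℝ, V) 𝓘(ℝ, G) f x
      ((mfderiv 𝓘(ℂ, V) 𝓘(ℂ, G) f x : V →L[ℂ] G).restrictScalars ℝ : V →L[ℝ] G) :=
    ⟨h1.1, h1.2.restrictScalars ℝ⟩
  have h3 : mvfderiv 𝓘(ℝ, V) f x =
      ((mfderiv 𝓘(ℂ, V) 𝓘(ℂ, G) f x : V →L[ℂ] G).restrictScalars ℝ : V →L[ℝ] G) := h2.mfderiv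
  rw [h3]
  exact (mfderiv 𝓘(ℂ, V) 𝓘(ℂ, G) f x : V →L[ℂ] G).map_smul Complex.I (v : V)

theorem mvfderiv_eq_of_eventuallyEq {f g : X → G} {x : X} (h : f =ᶠ[𝓝 x] g) :
    mvfderiv 𝓘(ℝ, V) f x = mvfderiv 𝓘(ℝ, V) g x := by
  ext v
  have : mfderiv 𝓘(ℝ, V) 𝓘(ℝ, G) f x = mfderiv 𝓘(ℝ, V) 𝓘(ℝ, G) g x := h.mfderiv_eq
  exact congrArg (fun L : V →L[ℝ] G ↦ L v) this

theorem mvfderiv_clm_comp {G' : Type*} [NormedAddCommGroup G'] [NormedSpace ℂ G'] (L : G →L[ℝ] G')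
    {f : X → G} {x : X} (hf : MDifferentiableAt 𝓘(ℝ, V) 𝓘(ℝ, G) f x)
    (v : TangentSpace 𝓘(ℝ, V) x) :
    mvfderiv 𝓘(ℝ, V) (fun y ↦ L (f y)) x v = L (mvfderiv 𝓘(ℝ, V) f x v) := by
  have h : HasMFDerivAt 𝓘(ℝ, V) 𝓘(ℝ, G') (fun y ↦ L (f y)) x
      (L.comp (mfderiv 𝓘(ℝ, V) 𝓘(ℝ, G) f x : V →L[ℝ] G) : V →L[ℝ] G') :=
    HasMFDerivAt.comp x L.hasMFDerivAt hf.hasMFDerivAt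
  exact congrArg (fun L : V →L[ℝ] G' ↦ L v) h.mfderiv

theorem mvfderiv_eq_fderiv {f : X → G} {x : X} (hf : MDifferentiableAt 𝓘(ℝ, V) 𝓘(ℝ, G) f x)
    (v : TangentSpace 𝓘(ℝ, V) x) :
    mvfderiv 𝓘(ℝ, V) f x v =
      fderiv ℝ (f ∘ (extChartAt 𝓘(ℝ, V) x).symm) (extChartAt 𝓘(ℝ, V) x x) (v : V) := by
  have : mfderiv 𝓘(ℝ, V) 𝓘(ℝ, G) f x =
      fderiv ℝ (f ∘ (extChartAt 𝓘(ℝ, V) x).symm) (extChartAt 𝓘(ℝ, V) x x) := by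
    rw [hf.mfderiv, ← fderivWithin_univ]
    exact congrArg (fun t ↦ fderivWithin ℝ (f ∘ (extChartAt 𝓘(ℝ, V) x).symm) t
      (extChartAt 𝓘(ℝ, V) x x)) (ModelWithCorners.range_eq_univ _)
  exact congrArg (fun L : V →L[ℝ] G ↦ L v) this

theorem differentiableAt_comp_extChartAt_symm {f : X → G} {x : X}
    (hf : MDifferentiableAt 𝓘(ℝ, V) 𝓘(ℝ, G) f x) :
    DifferentiableAt ℝ (f ∘ (extChartAt 𝓘(ℝ, V) x).symm) (extChartAt 𝓘(ℝ, V) x x) := by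
  have := (mdifferentiableAt_iff f x).1 hf |>.2
  rw [ModelWithCorners.range_eq_univ, differentiableWithinAt_univ] at this
  exact this

theorem mdifferentiableAt_smul_complex {a : X → ℂ} {f : X → G} {x : X}
    (ha : MDifferentiableAt 𝓘(ℝ, V) 𝓘(ℝ, ℂ) a x) (hf : MDifferentiableAt 𝓘(ℝ, V) 𝓘(ℝ, G) f x) :
    MDifferentiableAt 𝓘(ℝ, V) 𝓘(ℝ, G) (fun y ↦ a y • f y) x := by
  rw [mdifferentiableAt_iff, ModelWithCorners.range_eq_univ, differentiableWithinAt_univ]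
  exact ⟨ha.continuousAt.smul hf.continuousAt, (differentiableAt_comp_extChartAt_symm ha).smul
    (differentiableAt_comp_extChartAt_symm hf)⟩

/-- The Leibniz rule for a complex valued function and a vector valued one. -/
theorem mvfderiv_smul_complex {a : X → ℂ} {f : X → G} {x : X}
    (ha : MDifferentiableAt 𝓘(ℝ, V) 𝓘(ℝ, ℂ) a x) (hf : MDifferentiableAt 𝓘(ℝ, V) 𝓘(ℝ, G) f x)
    (v : TangentSpace 𝓘(ℝ, V) x) :
    mvfderiv 𝓘(ℝ, V) (fun y ↦ a y • f y) x v =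
      mvfderiv 𝓘(ℝ, V) a x v • f x + a x • mvfderiv 𝓘(ℝ, V) f x v := by
  have haf := mdifferentiableAt_smul_complex ha hf
  rw [mvfderiv_eq_fderiv ha, mvfderiv_eq_fderiv hf, mvfderiv_eq_fderiv haf]
  have h := fderiv_fun_smul (differentiableAt_comp_extChartAt_symm ha)
    (differentiableAt_comp_extChartAt_symm hf)
  have h' := congrArg (fun L : V →L[ℝ] G ↦ L v) h
  refine h'.trans ?_
  have hx : (extChartAt 𝓘(ℝ, V) x).symm (extChartAt 𝓘(ℝ, V) x x) = x := extChartAt_to_inv (I := 𝓘(ℝ, V)) x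
  set z := extChartAt 𝓘(ℝ, V) x x
  set φ := (extChartAt 𝓘(ℝ, V) x).symm
  change a (φ z) • (fderiv ℝ (f ∘ φ) z : V →L[ℝ] G) v +
    (fderiv ℝ (a ∘ φ) z : V →L[ℝ] ℂ) v • f (φ z) = _
  rw [hx, add_comm]

variable [IsManifold 𝓘(ℂ, V) ω X]

/-- The differential of `f` at a point `y` of the chart around `x`, in the coordinates of that
chart. -/
theorem mvfderiv_eq_fderiv_chart {f : X → G} {x y : X} (hy : y ∈ (chartAt V x).source)
    (hf : MDifferentiableAt 𝓘(ℝ, V) 𝓘(ℝ, G) f y) (u : TangentSpace 𝓘(ℝ, V) y) :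
    mvfderiv 𝓘(ℝ, V) f y u =
      fderiv ℝ (f ∘ (extChartAt 𝓘(ℝ, V) x).symm) (extChartAt 𝓘(ℝ, V) x y)
        ((trivializationAt V (TangentSpace 𝓘(ℝ, V)) x).continuousLinearMapAt ℝ y u) := by
  have : IsManifold 𝓘(ℝ, V) 1 X := IsManifold.of_le (n := ∞) (by simp)
  rw [TangentBundle.continuousLinearMapAt_trivializationAt hy]
  have hy' : y ∈ (extChartAt 𝓘(ℝ, V) x).source := by rwa [extChartAt_source]
  have hinv := (extChartAt 𝓘(ℝ, V) x).left_inv hy'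
  have h1 : MDifferentiableAt 𝓘(ℝ, V) 𝓘(ℝ, V) (extChartAt 𝓘(ℝ, V) x) y :=
    mdifferentiableAt_extChartAt hy
  have h2 : MDifferentiableAt 𝓘(ℝ, V) 𝓘(ℝ, V) (extChartAt 𝓘(ℝ, V) x).symm
      (extChartAt 𝓘(ℝ, V) x y) := by
    have := mdifferentiableWithinAt_extChartAt_symm (I := 𝓘(ℝ, V))
      ((extChartAt 𝓘(ℝ, V) x).map_source hy')
    rwa [ModelWithCorners.range_eq_univ, mdifferentiableWithinAt_univ] at this
  have h3 : MDifferentiableAt 𝓘(ℝ, V) 𝓘(ℝ, G) (f ∘ (extChartAt 𝓘(ℝ, V) x).symm)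
      (extChartAt 𝓘(ℝ, V) x y) := by
    refine MDifferentiableAt.comp _ ?_ h2
    rwa [hinv]
  have h4 : f =ᶠ[𝓝 y] (f ∘ (extChartAt 𝓘(ℝ, V) x).symm) ∘ (extChartAt 𝓘(ℝ, V) x) := by
    filter_upwards [extChartAt_source_mem_nhds' hy'] with z hz
    exact congrArg f ((extChartAt 𝓘(ℝ, V) x).left_inv hz).symm
  rw [mvfderiv_eq_of_eventuallyEq h4]
  have h5 : mfderiv 𝓘(ℝ, V) 𝓘(ℝ, G) (f ∘ (extChartAt 𝓘(ℝ, V) x).symm) (extChartAt 𝓘(ℝ, V) x y) =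
      fderiv ℝ (f ∘ (extChartAt 𝓘(ℝ, V) x).symm) (extChartAt 𝓘(ℝ, V) x y) := mfderiv_eq_fderiv
  exact (congrArg (fun L : V →L[ℝ] G ↦ L u) (mfderiv_comp y h3 h1)).trans
    (congrArg (fun L : V →L[ℝ] G ↦ L (mfderiv 𝓘(ℝ, V) 𝓘(ℝ, V) (extChartAt 𝓘(ℝ, V) x) y u)) h5)

/-- The derivative of a smooth function along a smooth vector field is smooth. -/
theorem contMDiffAt_mvfderiv_apply {f : X → G} {x : X}
    (hf : ContMDiffAt 𝓘(ℝ, V) 𝓘(ℝ, G) ∞ f x) {W : ∀ y : X, TangentSpace 𝓘(ℝ, V) y}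
    (hW : SmoothAt V V W x) :
    ContMDiffAt 𝓘(ℝ, V) 𝓘(ℝ, G) ∞ (fun y ↦ mvfderiv 𝓘(ℝ, V) f y (W y)) x := by
  have : IsManifold 𝓘(ℝ, V) 1 X := IsManifold.of_le (n := ∞) (by simp)
  have hd : ∀ᶠ y in 𝓝 x, MDifferentiableAt 𝓘(ℝ, V) 𝓘(ℝ, G) f y :=
    ((contMDiffAt_iff_contMDiffAt_nhds (n := 1) (by simp)).1
      (hf.of_le (by simp))).mono fun _ hy ↦ hy.mdifferentiableAt one_ne_zero
  have hchart : (chartAt V x).source ∈ 𝓝 x := chart_source_mem_nhds V x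
  unfold SmoothAt at hW
  rw [contMDiffAt_section] at hW
  have h1 : ContDiffAt ℝ ∞ (f ∘ (extChartAt 𝓘(ℝ, V) x).symm) (extChartAt 𝓘(ℝ, V) x x) := by
    have := (contMDiffAt_iff.1 hf).2
    simpa using! this
  have h2 : ContDiffAt ℝ ∞ (fderiv ℝ (f ∘ (extChartAt 𝓘(ℝ, V) x).symm))
      (extChartAt 𝓘(ℝ, V) x x) := h1.fderiv_right (by simp)
  have h3 : ContMDiffAt 𝓘(ℝ, V) 𝓘(ℝ, V →L[ℝ] G) ∞
      (fun y ↦ fderiv ℝ (f ∘ (extChartAt 𝓘(ℝ, V) x).symm) (extChartAt 𝓘(ℝ, V) x y)) x :=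
    h2.contMDiffAt.comp x contMDiffAt_extChartAt
  refine (h3.clm_apply hW).congr_of_eventuallyEq ?_
  filter_upwards [hd, hchart] with y hy hy'
  rw [mvfderiv_eq_fderiv_chart hy' hy, Trivialization.continuousLinearMapAt_apply_of_mem]
  simpa using hy'

end Calculus

/-! ### The complex structure and coordinate vector fields -/

section Tangent

variable {V : Type*} [NormedAddCommGroup V] [NormedSpace ℂ V]
  {X : Type*} [TopologicalSpace X] [ChartedSpace V X] [IsManifold 𝓘(ℂ, V) ω X]

/-- The real tangent coordinate changes are the holomorphic ones. -/
theorem tangentCoordChange_real (x y : X) {z : X} (hx : z ∈ (chartAt V x).source)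
    (hy : z ∈ (chartAt V y).source) (v : V) :
    tangentCoordChange 𝓘(ℝ, V) x y z v = tangentCoordChange 𝓘(ℂ, V) x y z v := by
  have : IsManifold 𝓘(ℝ, V) 1 X := IsManifold.of_le (n := ∞) (by simp)
  have : IsManifold 𝓘(ℂ, V) 1 X := IsManifold.of_le (n := ω) (by simp)
  have h1 := hasFDerivWithinAt_tangentCoordChange (I := 𝓘(ℝ, V)) (x := x) (y := y) (z := z)
    (by simp only [extChartAt_source]; exact ⟨hx, hy⟩)
  have h2 := (hasFDerivWithinAt_tangentCoordChange (I := 𝓘(ℂ, V)) (x := x) (y := y) (z := z)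
    (by simp only [extChartAt_source]; exact ⟨hx, hy⟩)).restrictScalars ℝ
  rw [ModelWithCorners.range_eq_univ, hasFDerivWithinAt_univ] at h1 h2
  exact congrArg (fun L : V →L[ℝ] V ↦ L v) (h1.unique h2)

theorem continuousLinearMapAt_tangent_real {x y : X} (hy : y ∈ (chartAt V x).source) (v : V) :
    (trivializationAt V (TangentSpace 𝓘(ℝ, V)) x).continuousLinearMapAt ℝ y v =
      (trivializationAt V (TangentSpace 𝓘(ℂ, V)) x).continuousLinearMapAt ℂ y v := by
  have : IsManifold 𝓘(ℝ, V) 1 X := IsManifold.of_le (n := ∞) (by simp)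
  have : IsManifold 𝓘(ℂ, V) 1 X := IsManifold.of_le (n := ω) (by simp)
  rw [TangentBundle.continuousLinearMapAt_trivializationAt_eq_core hy,
    TangentBundle.continuousLinearMapAt_trivializationAt_eq_core hy]
  exact tangentCoordChange_real y x (mem_chart_source V y) hy v

theorem symmL_tangent_real {x y : X} (hy : y ∈ (chartAt V x).source) (v : V) :
    (trivializationAt V (TangentSpace 𝓘(ℝ, V)) x).symmL ℝ y v =
      (trivializationAt V (TangentSpace 𝓘(ℂ, V)) x).symmL ℂ y v := by
  have : IsManifold 𝓘(ℝ, V) 1 X := IsManifold.of_le (n := ∞) (by simp)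
  have : IsManifold 𝓘(ℂ, V) 1 X := IsManifold.of_le (n := ω) (by simp)
  rw [TangentBundle.symmL_trivializationAt_eq_core hy,
    TangentBundle.symmL_trivializationAt_eq_core hy]
  exact tangentCoordChange_real x y hy (mem_chart_source V y) v

theorem continuousLinearMapAt_cplx {x y : X} (hy : y ∈ (chartAt V x).source)
    (v : TangentSpace 𝓘(ℝ, V) y) :
    (trivializationAt V (TangentSpace 𝓘(ℝ, V)) x).continuousLinearMapAt ℝ y (cplx y v) =
      Complex.I •
        (trivializationAt V (TangentSpace 𝓘(ℝ, V)) x).continuousLinearMapAt ℝ y v := by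
  refine (continuousLinearMapAt_tangent_real hy _).trans ?_
  refine Eq.trans ?_ (congrArg (Complex.I • ·) (continuousLinearMapAt_tangent_real hy v).symm)
  exact ((trivializationAt V (TangentSpace 𝓘(ℂ, V)) x).continuousLinearMapAt ℂ y).map_smul
    Complex.I v

theorem symmL_cplx {x y : X} (hy : y ∈ (chartAt V x).source) (v : V) :
    (trivializationAt V (TangentSpace 𝓘(ℝ, V)) x).symmL ℝ y (Complex.I • v) =
      cplx y ((trivializationAt V (TangentSpace 𝓘(ℝ, V)) x).symmL ℝ y v) := by
  refine (symmL_tangent_real hy _).trans ?_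
  refine Eq.trans ?_ (congrArg (cplx y) (symmL_tangent_real hy v).symm)
  exact ((trivializationAt V (TangentSpace 𝓘(ℂ, V)) x).symmL ℂ y).map_smul Complex.I v

/-- The complex structure maps smooth vector fields to smooth vector fields. -/
theorem SmoothAt.cplx {W : ∀ y : X, TangentSpace 𝓘(ℝ, V) y} {x : X} (hW : SmoothAt V V W x) :
    SmoothAt V V (fun y ↦ cplx y (W y)) x := by
  unfold SmoothAt at hW ⊢
  rw [contMDiffAt_section] at hW ⊢
  have h := (ContinuousLinearMap.contMDiff (n := ∞)
    ((ContinuousLinearMap.lsmul ℝ ℂ Complex.I : V →L[ℝ] V))).contMDiffAt.comp x hW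
  refine h.congr_of_eventuallyEq ?_
  filter_upwards [chart_source_mem_nhds V x] with y hy
  have hb : y ∈ (trivializationAt V (TangentSpace 𝓘(ℝ, V)) x).baseSet := by simpa using hy
  have h1 := continuousLinearMapAt_cplx hy (W y)
  rwa [Trivialization.continuousLinearMapAt_apply_of_mem _ _ hb,
    Trivialization.continuousLinearMapAt_apply_of_mem _ _ hb] at h1

/-- Near `x`, the extension of `i v` is `i` times the extension of `v`. -/
theorem ext_cplx {x y : X} (hy : y ∈ (chartAt V x).source) (v : TangentSpace 𝓘(ℝ, V) x) :
    ext ℝ V (cplx x v) y = cplx y (ext ℝ V v y) := by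
  have h := continuousLinearMapAt_cplx (mem_chart_source V x) v
  unfold ext
  rw [← symmL_cplx hy]
  exact congrArg ((trivializationAt V (TangentSpace 𝓘(ℝ, V)) x).symmL ℝ y) h

/-- The coordinate vector fields are holomorphic. -/
theorem holomorphicAt_ext {x : X} (v : TangentSpace 𝓘(ℝ, V) x) :
    HolomorphicAt V V (E := fun y : X ↦ TangentSpace 𝓘(ℂ, V) y)
      (fun y ↦ (ext ℝ V v y : V)) x := by
  have h : HolomorphicAt V V (E := fun y : X ↦ TangentSpace 𝓘(ℂ, V) y)
      (ext ℂ V (E := fun y : X ↦ TangentSpace 𝓘(ℂ, V) y) (x := x) (v : V)) x := by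
    unfold HolomorphicAt
    rw [contMDiffAt_section]
    exact contMDiffAt_const.congr_of_eventuallyEq
      (ext_coord ℂ V (E := fun y : X ↦ TangentSpace 𝓘(ℂ, V) y) (x := x) (v : V))
  refine ContMDiffAt.congr_of_eventuallyEq h ?_
  filter_upwards [chart_source_mem_nhds V x] with y hy
  have h1 := continuousLinearMapAt_tangent_real (mem_chart_source V x) v
  have h2 := symmL_tangent_real hy
    ((trivializationAt V (TangentSpace 𝓘(ℝ, V)) x).continuousLinearMapAt ℝ x v)
  refine congrArg (TotalSpace.mk' V (E := fun y : X ↦ TangentSpace 𝓘(ℂ, V) y) y) ?_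
  exact h2.trans (congrArg ((trivializationAt V (TangentSpace 𝓘(ℂ, V)) x).symmL ℂ y) h1)

theorem continuousLinearMapAt_ext {x y : X} (hy : y ∈ (chartAt V x).source)
    (v : TangentSpace 𝓘(ℝ, V) x) :
    (trivializationAt V (TangentSpace 𝓘(ℝ, V)) x).continuousLinearMapAt ℝ y (ext ℝ V v y) =
      (trivializationAt V (TangentSpace 𝓘(ℝ, V)) x).continuousLinearMapAt ℝ x v := by
  have hb : y ∈ (trivializationAt V (TangentSpace 𝓘(ℝ, V)) x).baseSet := by simpa using hy
  exact Trivialization.continuousLinearMapAt_symmL _ hb _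

theorem inverse_apply_of_apply_eq {M N : Type*} [TopologicalSpace M] [AddCommGroup M] [Module ℝ M]
    [TopologicalSpace N] [AddCommGroup N] [Module ℝ N] {A : M →L[ℝ] N} (hA : A.IsInvertible)
    {v : M} {w : N} (h : A v = w) : A.inverse w = v := by
  obtain ⟨B, rfl⟩ := hA
  rw [ContinuousLinearMap.inverse_equiv, ← h]
  exact B.symm_apply_apply v

/-- Coordinate vector fields commute. -/
theorem mlieBracket_ext (x : X) (u v : TangentSpace 𝓘(ℝ, V) x) :
    VectorField.mlieBracket 𝓘(ℝ, V) (ext ℝ V u) (ext ℝ V v) x = 0 := by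
  have : IsManifold 𝓘(ℝ, V) 1 X := IsManifold.of_le (n := ∞) (by simp)
  have key (u : TangentSpace 𝓘(ℝ, V) x) :
      VectorField.mpullbackWithin 𝓘(ℝ, V) 𝓘(ℝ, V) (extChartAt 𝓘(ℝ, V) x).symm (ext ℝ V u)
        (Set.range 𝓘(ℝ, V)) =ᶠ[𝓝 (extChartAt 𝓘(ℝ, V) x x)] fun _ ↦
          (trivializationAt V (TangentSpace 𝓘(ℝ, V)) x).continuousLinearMapAt ℝ x u := by
    filter_upwards [extChartAt_target_mem_nhds (I := 𝓘(ℝ, V)) x] with w hw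
    have hs := (extChartAt 𝓘(ℝ, V) x).map_target hw
    rw [extChartAt_source] at hs
    rw [VectorField.mpullbackWithin_apply]
    refine inverse_apply_of_apply_eq (isInvertible_mfderivWithin_extChartAt_symm hw) ?_
    unfold ext
    rw [TangentBundle.symmL_trivializationAt hs, (extChartAt 𝓘(ℝ, V) x).right_inv hw]
    rfl
  rw [← VectorField.mlieBracketWithin_univ, VectorField.mlieBracketWithin_apply,
    (key u).lieBracketWithin_vectorField_eq_nhds (key v)]
  simp only [VectorField.lieBracketWithin, fderivWithin_fun_const]
  simp only [Pi.zero_apply, zero_apply, sub_zero]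
  exact map_zero _

/-- Second derivatives along coordinate vector fields are symmetric. -/
theorem mvfderiv_ext_comm {G : Type*} [NormedAddCommGroup G] [NormedSpace ℂ G] {f : X → G} {x : X}
    (hf : ContMDiffAt 𝓘(ℝ, V) 𝓘(ℝ, G) ∞ f x) (u v : TangentSpace 𝓘(ℝ, V) x) :
    mvfderiv 𝓘(ℝ, V) (fun y ↦ mvfderiv 𝓘(ℝ, V) f y (ext ℝ V u y)) x v =
      mvfderiv 𝓘(ℝ, V) (fun y ↦ mvfderiv 𝓘(ℝ, V) f y (ext ℝ V v y)) x u := by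
  have hd : ∀ᶠ y in 𝓝 x, MDifferentiableAt 𝓘(ℝ, V) 𝓘(ℝ, G) f y :=
    ((contMDiffAt_iff_contMDiffAt_nhds (n := 1) (by simp)).1
      (hf.of_le (by simp))).mono fun _ hy ↦ hy.mdifferentiableAt one_ne_zero
  set φ := f ∘ (extChartAt 𝓘(ℝ, V) x).symm with hφ
  set z := extChartAt 𝓘(ℝ, V) x x with hz
  set L := (trivializationAt V (TangentSpace 𝓘(ℝ, V)) x).continuousLinearMapAt ℝ x with hL
  have h1 : ContDiffAt ℝ ∞ φ z := by
    have h := (contMDiffAt_iff.1 hf).2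
    rw [ModelWithCorners.range_eq_univ, contDiffWithinAt_univ] at h
    exact h
  have h2 : DifferentiableAt ℝ (fderiv ℝ φ) z :=
    (h1.fderiv_right (m := ∞) (by simp)).differentiableAt (by simp)
  have key (u v : TangentSpace 𝓘(ℝ, V) x) :
      mvfderiv 𝓘(ℝ, V) (fun y ↦ mvfderiv 𝓘(ℝ, V) f y (ext ℝ V u y)) x v =
        fderiv ℝ (fderiv ℝ φ) z (L v) (L u) := by
    have h3 := (contMDiffAt_mvfderiv_apply hf
      (Connection.smoothAt_extTangent u)).mdifferentiableAt (by simp)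
    rw [mvfderiv_eq_fderiv_chart (mem_chart_source V x) h3]
    have h4 : (fun y ↦ mvfderiv 𝓘(ℝ, V) f y (ext ℝ V u y)) ∘ (extChartAt 𝓘(ℝ, V) x).symm
        =ᶠ[𝓝 z] fun w ↦ fderiv ℝ φ w (L u) := by
      have hc : Filter.Tendsto (extChartAt 𝓘(ℝ, V) x).symm (𝓝 z) (𝓝 x) := by
        have := continuousAt_extChartAt_symm (I := 𝓘(ℝ, V)) x
        rwa [ContinuousAt, extChartAt_to_inv] at this
      filter_upwards [hc hd, hc (chart_source_mem_nhds V x), extChartAt_target_mem_nhds x]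
        with w hw hw' hw''
      simp only [Function.comp_apply]
      rw [mvfderiv_eq_fderiv_chart hw' hw, continuousLinearMapAt_ext hw',
        (extChartAt 𝓘(ℝ, V) x).right_inv hw'']
    rw [h4.fderiv_eq, fderiv_clm_apply h2 (differentiableAt_const _)]
    simp [hL]
  rw [key, key]
  exact (h1.isSymmSndFDerivAt (by
    rw [minSmoothness_of_isRCLikeNormedField]
    exact WithTop.coe_le_coe.2 (le_top : (2 : ℕ∞) ≤ ⊤))) _ _

end Tangent

/-! ### The operators `∂` and `∂̄` on functions -/

section Functions

variable {V : Type*} [NormedAddCommGroup V] [NormedSpace ℂ V]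
  {X : Type*} [TopologicalSpace X] [ChartedSpace V X]
  {G : Type*} [NormedAddCommGroup G] [NormedSpace ℂ G]

/-- The complex linear part `∂f` of the differential of a function `f`. -/
def del (f : X → G) (x : X) (v : TangentSpace 𝓘(ℝ, V) x) : G :=
  (1 / 2 : ℂ) • (mvfderiv 𝓘(ℝ, V) f x v - Complex.I • mvfderiv 𝓘(ℝ, V) f x (cplx x v))

/-- The conjugate linear part `∂̄f` of the differential of a function `f`. -/
def delbar (f : X → G) (x : X) (v : TangentSpace 𝓘(ℝ, V) x) : G :=
  (1 / 2 : ℂ) • (mvfderiv 𝓘(ℝ, V) f x v + Complex.I • mvfderiv 𝓘(ℝ, V) f x (cplx x v))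

theorem del_add_delbar (f : X → G) (x : X) (v : TangentSpace 𝓘(ℝ, V) x) :
    del f x v + delbar f x v = mvfderiv 𝓘(ℝ, V) f x v := by
  unfold del delbar
  module

theorem del_cplx (f : X → G) (x : X) (v : TangentSpace 𝓘(ℝ, V) x) :
    del f x (cplx x v) = Complex.I • del f x v := by
  simp only [del, cplx_cplx, map_neg]
  match_scalars
  · ring_nf
    norm_num
  · ring

theorem delbar_cplx (f : X → G) (x : X) (v : TangentSpace 𝓘(ℝ, V) x) :
    delbar f x (cplx x v) = -Complex.I • delbar f x v := by
  simp only [delbar, cplx_cplx, map_neg]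
  match_scalars
  · ring_nf
    norm_num
  · ring

theorem delbar_of_holomorphic {f : X → G} {x : X} (hf : MDifferentiableAt 𝓘(ℂ, V) 𝓘(ℂ, G) f x)
    (v : TangentSpace 𝓘(ℝ, V) x) : delbar f x v = 0 := by
  rw [delbar, mvfderiv_cplx_of_holomorphic hf, smul_smul, Complex.I_mul_I]
  simp

theorem del_add {f g : X → G} {x : X} (hf : MDifferentiableAt 𝓘(ℝ, V) 𝓘(ℝ, G) f x)
    (hg : MDifferentiableAt 𝓘(ℝ, V) 𝓘(ℝ, G) g x) (v : TangentSpace 𝓘(ℝ, V) x) :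
    del (fun y ↦ f y + g y) x v = del f x v + del g x v := by
  simp only [del, mvfderiv_fun_add hf hg, add_apply]
  module

theorem delbar_add {f g : X → G} {x : X} (hf : MDifferentiableAt 𝓘(ℝ, V) 𝓘(ℝ, G) f x)
    (hg : MDifferentiableAt 𝓘(ℝ, V) 𝓘(ℝ, G) g x) (v : TangentSpace 𝓘(ℝ, V) x) :
    delbar (fun y ↦ f y + g y) x v = delbar f x v + delbar g x v := by
  simp only [delbar, mvfderiv_fun_add hf hg, add_apply]
  module

theorem del_smul {a : X → ℂ} {f : X → G} {x : X}
    (ha : MDifferentiableAt 𝓘(ℝ, V) 𝓘(ℝ, ℂ) a x) (hf : MDifferentiableAt 𝓘(ℝ, V) 𝓘(ℝ, G) f x)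
    (v : TangentSpace 𝓘(ℝ, V) x) :
    del (fun y ↦ a y • f y) x v = del a x v • f x + a x • del f x v := by
  simp only [del, mvfderiv_smul_complex ha hf, smul_eq_mul]
  module

theorem delbar_smul {a : X → ℂ} {f : X → G} {x : X}
    (ha : MDifferentiableAt 𝓘(ℝ, V) 𝓘(ℝ, ℂ) a x) (hf : MDifferentiableAt 𝓘(ℝ, V) 𝓘(ℝ, G) f x)
    (v : TangentSpace 𝓘(ℝ, V) x) :
    delbar (fun y ↦ a y • f y) x v = delbar a x v • f x + a x • delbar f x v := by
  simp only [delbar, mvfderiv_smul_complex ha hf, smul_eq_mul]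
  module

theorem del_congr {f g : X → G} {x : X} (h : f =ᶠ[𝓝 x] g) (v : TangentSpace 𝓘(ℝ, V) x) :
    del f x v = del g x v := by
  simp only [del, mvfderiv_eq_of_eventuallyEq h]

theorem delbar_congr {f g : X → G} {x : X} (h : f =ᶠ[𝓝 x] g) (v : TangentSpace 𝓘(ℝ, V) x) :
    delbar f x v = delbar g x v := by
  simp only [delbar, mvfderiv_eq_of_eventuallyEq h]

theorem mdifferentiableAt_conj {f : X → ℂ} {x : X}
    (hf : MDifferentiableAt 𝓘(ℝ, V) 𝓘(ℝ, ℂ) f x) :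
    MDifferentiableAt 𝓘(ℝ, V) 𝓘(ℝ, ℂ) (fun y ↦ conj (f y)) x :=
  (Complex.conjCLE : ℂ →L[ℝ] ℂ).mdifferentiableAt.comp x hf

theorem del_conj {f : X → ℂ} {x : X} (hf : MDifferentiableAt 𝓘(ℝ, V) 𝓘(ℝ, ℂ) f x)
    (v : TangentSpace 𝓘(ℝ, V) x) : del (fun y ↦ conj (f y)) x v = conj (delbar f x v) := by
  have h (v : TangentSpace 𝓘(ℝ, V) x) : mvfderiv 𝓘(ℝ, V) (fun y ↦ conj (f y)) x v =
      conj (mvfderiv 𝓘(ℝ, V) f x v) := mvfderiv_clm_comp (Complex.conjCLE : ℂ →L[ℝ] ℂ) hf v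
  simp only [del, delbar, h, smul_eq_mul, map_mul, map_add, map_div₀, map_one, Complex.conj_I,
    Complex.conj_ofNat]
  ring

theorem delbar_conj {f : X → ℂ} {x : X} (hf : MDifferentiableAt 𝓘(ℝ, V) 𝓘(ℝ, ℂ) f x)
    (v : TangentSpace 𝓘(ℝ, V) x) : delbar (fun y ↦ conj (f y)) x v = conj (del f x v) := by
  have h := del_conj (mdifferentiableAt_conj hf) v
  simp only [Complex.conj_conj] at h
  rw [h, Complex.conj_conj]

theorem contMDiffAt_const_smul (c : ℂ) {g : X → G} {x : X}
    (hg : ContMDiffAt 𝓘(ℝ, V) 𝓘(ℝ, G) ∞ g x) :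
    ContMDiffAt 𝓘(ℝ, V) 𝓘(ℝ, G) ∞ (fun y ↦ c • g y) x :=
  (ContinuousLinearMap.lsmul ℝ ℂ c : G →L[ℝ] G).contMDiff.contMDiffAt.comp x hg

variable [IsManifold 𝓘(ℂ, V) ω X]

theorem contMDiffAt_del {f : X → G} {x : X} (hf : ContMDiffAt 𝓘(ℝ, V) 𝓘(ℝ, G) ∞ f x)
    {W : ∀ y : X, TangentSpace 𝓘(ℝ, V) y} (hW : SmoothAt V V W x) :
    ContMDiffAt 𝓘(ℝ, V) 𝓘(ℝ, G) ∞ (fun y ↦ del f y (W y)) x := by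
  have h1 := contMDiffAt_mvfderiv_apply hf hW
  have h2 := contMDiffAt_mvfderiv_apply hf hW.cplx
  exact contMDiffAt_const_smul _ (h1.sub (contMDiffAt_const_smul _ h2))

theorem contMDiffAt_delbar {f : X → G} {x : X} (hf : ContMDiffAt 𝓘(ℝ, V) 𝓘(ℝ, G) ∞ f x)
    {W : ∀ y : X, TangentSpace 𝓘(ℝ, V) y} (hW : SmoothAt V V W x) :
    ContMDiffAt 𝓘(ℝ, V) 𝓘(ℝ, G) ∞ (fun y ↦ delbar f y (W y)) x := by
  have h1 := contMDiffAt_mvfderiv_apply hf hW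
  have h2 := contMDiffAt_mvfderiv_apply hf hW.cplx
  exact contMDiffAt_const_smul _ (h1.add (contMDiffAt_const_smul _ h2))

end Functions

/-! ### Holomorphic sections, holomorphic frames and the operator `d''` -/

section HolomorphicSections

variable {V : Type*} [NormedAddCommGroup V] [NormedSpace ℂ V]
  {X : Type*} [TopologicalSpace X] [ChartedSpace V X]
  {F : Type*} [NormedAddCommGroup F] [NormedSpace ℂ F]
  {E : X → Type*} [TopologicalSpace (TotalSpace F E)] [∀ x, TopologicalSpace (E x)]
  [FiberBundle F E]

theorem HolomorphicAt.mdifferentiableAt_coord {s : ∀ y, E y} {x : X} (h : HolomorphicAt V F s x) :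
    MDifferentiableAt 𝓘(ℂ, V) 𝓘(ℂ, F)
      (fun y ↦ (trivializationAt F E x (TotalSpace.mk' F y (s y))).2) x := by
  unfold HolomorphicAt at h
  rw [contMDiffAt_section] at h
  exact h.mdifferentiableAt (by simp)

theorem HolomorphicAt.smoothAt {s : ∀ y, E y} {x : X} (h : HolomorphicAt V F s x) :
    SmoothAt V F s x := by
  unfold HolomorphicAt at h
  unfold SmoothAt
  rw [contMDiffAt_section] at h ⊢
  have h1 := contMDiffAt_iff.1 h
  exact contMDiffAt_iff.2 ⟨h1.1, (h1.2.of_le le_top).restrict_scalars ℝ⟩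

theorem SmoothAt.congr {s t : ∀ y, E y} {x : X} (hs : SmoothAt V F s x)
    (h : ∀ᶠ y in 𝓝 x, t y = s y) : SmoothAt V F t x :=
  ContMDiffAt.congr_of_eventuallyEq hs (h.mono fun y hy ↦ congrArg (TotalSpace.mk' F y) hy)

variable [∀ x, AddCommGroup (E x)] [∀ x, Module ℂ (E x)]

theorem DiffAt.mdifferentiableAt_coord [VectorBundle ℂ F E] {s : ∀ y, E y} {x : X}
    (h : DiffAt V F s x) : MDifferentiableAt 𝓘(ℝ, V) 𝓘(ℝ, F)
      (fun y ↦ (trivializationAt F E x (TotalSpace.mk' F y (s y))).2) x := by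
  unfold DiffAt at h
  rwa [mdifferentiableAt_section] at h

variable [VectorBundle ℂ F E]

theorem coord_add_eventuallyEq (s t : ∀ y, E y) (x : X) :
    (fun y ↦ (trivializationAt F E x (TotalSpace.mk' F y ((s + t) y))).2) =ᶠ[𝓝 x] fun y ↦
      (trivializationAt F E x (TotalSpace.mk' F y (s y))).2 +
        (trivializationAt F E x (TotalSpace.mk' F y (t y))).2 := by
  filter_upwards [(trivializationAt F E x).open_baseSet.mem_nhds
    (FiberBundle.mem_baseSet_trivializationAt' x)] with y hy
  exact ((trivializationAt F E x).linear ℂ hy).map_add (s y) (t y)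

theorem coord_smul_eventuallyEq (a : X → ℂ) (s : ∀ y, E y) (x : X) :
    (fun y ↦ (trivializationAt F E x (TotalSpace.mk' F y (a y • s y))).2) =ᶠ[𝓝 x] fun y ↦
      a y • (trivializationAt F E x (TotalSpace.mk' F y (s y))).2 := by
  filter_upwards [(trivializationAt F E x).open_baseSet.mem_nhds
    (FiberBundle.mem_baseSet_trivializationAt' x)] with y hy
  exact ((trivializationAt F E x).linear ℂ hy).map_smul (a y) (s y)

theorem symmL_coord (s : ∀ y, E y) (x : X) :
    (trivializationAt F E x).symmL ℂ x (trivializationAt F E x (TotalSpace.mk' F x (s x))).2 =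
      s x := by
  have hx := FiberBundle.mem_baseSet_trivializationAt' (F := F) (E := E) x
  rw [← (trivializationAt F E x).continuousLinearMapAt_apply_of_mem ℂ hx]
  exact (trivializationAt F E x).symmL_continuousLinearMapAt hx (s x)

theorem dbar_eq (s : ∀ y, E y) (x : X) (v : TangentSpace 𝓘(ℝ, V) x) :
    dbar (F := F) s x v = (trivializationAt F E x).symmL ℂ x
      (delbar (fun y ↦ (trivializationAt F E x (TotalSpace.mk' F y (s y))).2) x v) := rfl

theorem dbar_congr {s t : ∀ y, E y} {x : X} (h : ∀ᶠ y in 𝓝 x, s y = t y)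
    (v : TangentSpace 𝓘(ℝ, V) x) : dbar (F := F) s x v = dbar (F := F) t x v := by
  rw [dbar_eq, dbar_eq, delbar_congr]
  filter_upwards [h] with y hy
  rw [hy]

theorem dbar_add {s t : ∀ y, E y} {x : X} (hs : DiffAt V F s x) (ht : DiffAt V F t x)
    (v : TangentSpace 𝓘(ℝ, V) x) :
    dbar (F := F) (s + t) x v = dbar (F := F) s x v + dbar (F := F) t x v := by
  rw [dbar_eq, delbar_congr (coord_add_eventuallyEq s t x),
    delbar_add hs.mdifferentiableAt_coord ht.mdifferentiableAt_coord, map_add, dbar_eq, dbar_eq]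

/-- The Leibniz rule for `d''`. -/
theorem dbar_smul {a : X → ℂ} {s : ∀ y, E y} {x : X}
    (ha : MDifferentiableAt 𝓘(ℝ, V) 𝓘(ℝ, ℂ) a x) (hs : DiffAt V F s x)
    (v : TangentSpace 𝓘(ℝ, V) x) :
    dbar (F := F) (fun y ↦ a y • s y) x v = delbar a x v • s x + a x • dbar (F := F) s x v := by
  rw [dbar_eq, delbar_congr (coord_smul_eventuallyEq a s x),
    delbar_smul ha hs.mdifferentiableAt_coord, map_add, map_smul, map_smul, dbar_eq, symmL_coord]

theorem dbar_of_holomorphic {s : ∀ y, E y} {x : X} (hs : HolomorphicAt V F s x)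
    (v : TangentSpace 𝓘(ℝ, V) x) : dbar (F := F) s x v = 0 := by
  rw [dbar_eq, delbar_of_holomorphic hs.mdifferentiableAt_coord, map_zero]

theorem dbar_cplx (s : ∀ y, E y) (x : X) (v : TangentSpace 𝓘(ℝ, V) x) :
    dbar (F := F) s x (cplx x v) = -Complex.I • dbar (F := F) s x v := by
  rw [dbar_eq, delbar_cplx, map_smul, dbar_eq]

theorem DiffAt.smul_fun {a : X → ℂ} {s : ∀ y, E y} {x : X}
    (ha : MDifferentiableAt 𝓘(ℝ, V) 𝓘(ℝ, ℂ) a x) (hs : DiffAt V F s x) :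
    DiffAt V F (fun y ↦ a y • s y) x := by
  unfold DiffAt
  rw [mdifferentiableAt_section]
  exact (mdifferentiableAt_smul_complex ha hs.mdifferentiableAt_coord).congr_of_eventuallyEq
    (coord_smul_eventuallyEq a s x)

theorem SmoothAt.smul_fun {a : X → ℂ} {s : ∀ y, E y} {x : X}
    (ha : ContMDiffAt 𝓘(ℝ, V) 𝓘(ℝ, ℂ) ∞ a x) (hs : SmoothAt V F s x) :
    SmoothAt V F (fun y ↦ a y • s y) x := by
  unfold SmoothAt at hs ⊢
  rw [contMDiffAt_section] at hs ⊢
  have h := ((ContinuousLinearMap.lsmul ℝ ℂ : ℂ →L[ℝ] F →L[ℝ] F).contMDiff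
    (n := ∞)).contMDiffAt.comp x ha
  exact (h.clm_apply hs).congr_of_eventuallyEq (coord_smul_eventuallyEq a s x)

theorem smoothAt_sum {ι : Type*} (S : Finset ι) {s : ι → ∀ y, E y} {x : X}
    (hs : ∀ i ∈ S, SmoothAt V F (s i) x) : SmoothAt V F (fun y ↦ ∑ i ∈ S, s i y) x :=
  ContMDiffAt.sum_section hs

variable [ContMDiffVectorBundle ω F E 𝓘(ℂ, V)]

theorem holomorphicAt_symmL {x₀ y : X} (hy : y ∈ (trivializationAt F E x₀).baseSet) (a : F) :
    HolomorphicAt V F (fun z ↦ (trivializationAt F E x₀).symmL ℂ z a) y := by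
  unfold HolomorphicAt
  rw [(trivializationAt F E x₀).contMDiffAt_section_iff hy]
  refine (contMDiffAt_const (c := a)).congr_of_eventuallyEq ?_
  filter_upwards [(trivializationAt F E x₀).open_baseSet.mem_nhds hy] with z hz
  rw [← (trivializationAt F E x₀).continuousLinearMapAt_apply_of_mem ℂ hz,
    (trivializationAt F E x₀).continuousLinearMapAt_symmL hz]

theorem holomorphicAt_ext_section {x y : X} (hy : y ∈ (trivializationAt F E x).baseSet) (e : E x) :
    HolomorphicAt V F (ext ℂ F e) y :=
  holomorphicAt_symmL hy _

/-- A finite sum of sections is differentiable, and `d''` is additive on it. -/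
theorem diffAt_sum {ι : Type*} (S : Finset ι) {s : ι → ∀ y, E y} {x : X}
    (hs : ∀ i ∈ S, DiffAt V F (s i) x) : DiffAt V F (fun y ↦ ∑ i ∈ S, s i y) x ∧
      ∀ v : TangentSpace 𝓘(ℝ, V) x,
        dbar (F := F) (fun y ↦ ∑ i ∈ S, s i y) x v = ∑ i ∈ S, dbar (F := F) (s i) x v := by
  classical
  induction S using Finset.induction_on with
  | empty =>
    have h : HolomorphicAt V F (fun y ↦ (0 : E y)) x := by
      have := holomorphicAt_symmL (V := V) (F := F) (E := E)
        (FiberBundle.mem_baseSet_trivializationAt' x) 0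
      simpa using this
    simpa using ⟨h.smoothAt.diffAt, fun v ↦ dbar_of_holomorphic h v⟩
  | insert i S hi ih =>
    obtain ⟨h1, h2⟩ := ih fun j hj ↦ hs j (Finset.mem_insert_of_mem hj)
    have h3 := hs i (Finset.mem_insert_self i S)
    have h4 : (fun y ↦ ∑ j ∈ insert i S, s j y) = s i + fun y ↦ ∑ j ∈ S, s j y := by
      funext y
      simp [Finset.sum_insert hi]
    rw [h4]
    have : ContMDiffVectorBundle 1 F E 𝓘(ℝ, V) := ContMDiffVectorBundle.of_le (n := ∞) (by simp)
    refine ⟨mdifferentiableAt_add_section h3 h1, fun v ↦ ?_⟩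
    rw [dbar_add h3 h1, h2, Finset.sum_insert hi]

variable [FiniteDimensional ℂ F]

variable (F E) in
/-- The holomorphic frame of `E` over the domain of the preferred trivialization at `x₀` which
corresponds to a basis of the model fiber. -/
def frame (x₀ : X) (i : Fin (Module.finrank ℂ F)) (y : X) : E y :=
  (trivializationAt F E x₀).symmL ℂ y (Module.finBasis ℂ F i)

/-- The coefficients of a section in the frame `frame F E x₀`. -/
def coeff (x₀ : X) (s : ∀ y, E y) (i : Fin (Module.finrank ℂ F)) (y : X) : ℂ :=
  (Module.finBasis ℂ F).coord i (trivializationAt F E x₀ (TotalSpace.mk' F y (s y))).2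

theorem eq_sum_coeff_smul_frame {x₀ y : X} (hy : y ∈ (trivializationAt F E x₀).baseSet)
    (s : ∀ y, E y) : s y = ∑ i, coeff (F := F) x₀ s i y • frame F E x₀ i y := by
  have h := congrArg ((trivializationAt F E x₀).symmL ℂ y)
    ((Module.finBasis ℂ F).sum_repr (trivializationAt F E x₀ (TotalSpace.mk' F y (s y))).2)
  rw [← (trivializationAt F E x₀).continuousLinearMapAt_apply_of_mem ℂ hy,
    (trivializationAt F E x₀).symmL_continuousLinearMapAt hy] at h
  rw [← h, map_sum]
  refine Finset.sum_congr rfl fun i _ ↦ ?_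
  rw [map_smul, (trivializationAt F E x₀).continuousLinearMapAt_apply_of_mem ℂ hy]
  rfl

theorem frame_linearIndependent {x₀ y : X} (hy : y ∈ (trivializationAt F E x₀).baseSet)
    (c : Fin (Module.finrank ℂ F) → ℂ) (h : ∑ i, c i • frame F E x₀ i y = 0) : c = 0 := by
  have h1 := congrArg ((trivializationAt F E x₀).continuousLinearMapAt ℂ y) h
  simp only [frame, map_sum, map_smul, map_zero,
    (trivializationAt F E x₀).continuousLinearMapAt_symmL hy] at h1
  funext i
  exact Fintype.linearIndependent_iff.1 (Module.finBasis ℂ F).linearIndependent c h1 i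

theorem holomorphicAt_frame {x₀ y : X} (hy : y ∈ (trivializationAt F E x₀).baseSet)
    (i : Fin (Module.finrank ℂ F)) : HolomorphicAt V F (frame F E x₀ i) y :=
  holomorphicAt_symmL hy _

theorem DiffAt.coeff {x₀ y : X} (hy : y ∈ (trivializationAt F E x₀).baseSet) {s : ∀ y, E y}
    (hs : DiffAt V F s y) (i : Fin (Module.finrank ℂ F)) :
    MDifferentiableAt 𝓘(ℝ, V) 𝓘(ℝ, ℂ) (coeff (F := F) x₀ s i) y := by
  unfold DiffAt at hs
  have : ContMDiffVectorBundle 1 F E 𝓘(ℝ, V) := ContMDiffVectorBundle.of_le (n := ∞) (by simp)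
  have h := ((trivializationAt F E x₀).mdifferentiableAt_section_iff 𝓘(ℝ, V) s hy).1 hs
  exact (((Module.finBasis ℂ F).coord i).toContinuousLinearMap.restrictScalars
    ℝ).mdifferentiableAt.comp y h

theorem SmoothAt.coeff {x₀ y : X} (hy : y ∈ (trivializationAt F E x₀).baseSet) {s : ∀ y, E y}
    (hs : SmoothAt V F s y) (i : Fin (Module.finrank ℂ F)) :
    ContMDiffAt 𝓘(ℝ, V) 𝓘(ℝ, ℂ) ∞ (coeff (F := F) x₀ s i) y := by
  unfold SmoothAt at hs
  have h := ((trivializationAt F E x₀).contMDiffAt_section_iff hy).1 hs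
  exact (((Module.finBasis ℂ F).coord i).toContinuousLinearMap.restrictScalars
    ℝ).contMDiff.contMDiffAt.comp y h

/-- The operator `d''` in any of the frames `frame F E x₀`. -/
theorem dbar_eq_sum {x₀ y : X} (hy : y ∈ (trivializationAt F E x₀).baseSet) {s : ∀ y, E y}
    (hs : DiffAt V F s y) (v : TangentSpace 𝓘(ℝ, V) y) :
    dbar (F := F) s y v =
      ∑ i, delbar (coeff (F := F) x₀ s i) y v • frame F E x₀ i y := by
  have h1 : ∀ᶠ z in 𝓝 y, s z = ∑ i, coeff (F := F) x₀ s i z • frame F E x₀ i z := by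
    filter_upwards [(trivializationAt F E x₀).open_baseSet.mem_nhds hy] with z hz
    exact eq_sum_coeff_smul_frame hz s
  have h2 (i) := (holomorphicAt_frame (V := V) hy i).smoothAt.diffAt
  rw [dbar_congr h1, (diffAt_sum Finset.univ fun i _ ↦ DiffAt.smul_fun (hs.coeff hy i) (h2 i)).2]
  refine Finset.sum_congr rfl fun i _ ↦ ?_
  rw [dbar_smul (hs.coeff hy i) (h2 i), dbar_of_holomorphic (holomorphicAt_frame hy i), smul_zero,
    add_zero]

end HolomorphicSections

/-! ### The Gram matrix of a hermitian metric in a holomorphic frame -/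

section SmoothMatrices

variable {V : Type*} [NormedAddCommGroup V] [NormedSpace ℂ V]
  {X : Type*} [TopologicalSpace X] [ChartedSpace V X]

theorem contMDiffAt_complex_mul {f g : X → ℂ} {x : X} (hf : ContMDiffAt 𝓘(ℝ, V) 𝓘(ℝ, ℂ) ∞ f x)
    (hg : ContMDiffAt 𝓘(ℝ, V) 𝓘(ℝ, ℂ) ∞ g x) :
    ContMDiffAt 𝓘(ℝ, V) 𝓘(ℝ, ℂ) ∞ (fun y ↦ f y * g y) x := by
  have h : ContMDiff (𝓘(ℝ, ℂ).prod 𝓘(ℝ, ℂ)) 𝓘(ℝ, ℂ) ∞ (fun p : ℂ × ℂ ↦ p.1 * p.2) := by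
    rw [← modelWithCornersSelf_prod, chartedSpaceSelf_prod]
    exact (contDiff_fst.mul contDiff_snd).contMDiff
  exact h.contMDiffAt.comp x (hf.prodMk hg)

theorem contMDiffAt_complex_sum {ι : Type*} (S : Finset ι) {f : ι → X → ℂ} {x : X}
    (hf : ∀ i ∈ S, ContMDiffAt 𝓘(ℝ, V) 𝓘(ℝ, ℂ) ∞ (f i) x) :
    ContMDiffAt 𝓘(ℝ, V) 𝓘(ℝ, ℂ) ∞ (fun y ↦ ∑ i ∈ S, f i y) x := contMDiffAt_finsetSum hf

theorem contMDiffAt_complex_prod {ι : Type*} (S : Finset ι) {f : ι → X → ℂ} {x : X}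
    (hf : ∀ i ∈ S, ContMDiffAt 𝓘(ℝ, V) 𝓘(ℝ, ℂ) ∞ (f i) x) :
    ContMDiffAt 𝓘(ℝ, V) 𝓘(ℝ, ℂ) ∞ (fun y ↦ ∏ i ∈ S, f i y) x := by
  classical
  induction S using Finset.induction_on with
  | empty => simpa using contMDiffAt_const
  | insert i S hi ih =>
    simp only [Finset.prod_insert hi]
    exact contMDiffAt_complex_mul (hf i (Finset.mem_insert_self i S))
      (ih fun j hj ↦ hf j (Finset.mem_insert_of_mem hj))

theorem contMDiffAt_det {n : ℕ} {A : X → Matrix (Fin n) (Fin n) ℂ} {x : X}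
    (hA : ∀ i j, ContMDiffAt 𝓘(ℝ, V) 𝓘(ℝ, ℂ) ∞ (fun y ↦ A y i j) x) :
    ContMDiffAt 𝓘(ℝ, V) 𝓘(ℝ, ℂ) ∞ (fun y ↦ (A y).det) x := by
  simp only [Matrix.det_apply']
  exact contMDiffAt_complex_sum _ fun σ _ ↦ contMDiffAt_complex_mul contMDiffAt_const
    (contMDiffAt_complex_prod _ fun i _ ↦ hA _ _)

theorem contMDiffAt_inv_apply {n : ℕ} {A : X → Matrix (Fin n) (Fin n) ℂ} {x : X}
    (hA : ∀ i j, ContMDiffAt 𝓘(ℝ, V) 𝓘(ℝ, ℂ) ∞ (fun y ↦ A y i j) x) (hx : (A x).det ≠ 0)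
    (i j : Fin n) : ContMDiffAt 𝓘(ℝ, V) 𝓘(ℝ, ℂ) ∞ (fun y ↦ (A y)⁻¹ i j) x := by
  simp only [Matrix.inv_def, Ring.inverse_eq_inv', Matrix.smul_apply, smul_eq_mul,
    Matrix.adjugate_apply]
  refine contMDiffAt_complex_mul ?_ (contMDiffAt_det fun k l ↦ ?_)
  · have h : ContDiffAt ℝ ∞ (fun z : ℂ ↦ z⁻¹) (A x).det := contDiffAt_inv ℝ hx
    exact h.contMDiffAt.comp x (contMDiffAt_det hA)
  · by_cases hk : k = j
    · subst hk
      simpa using contMDiffAt_const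
    · simpa [Matrix.updateRow_ne hk] using hA k l

end SmoothMatrices

section Gram

variable {V : Type*} [NormedAddCommGroup V] [NormedSpace ℂ V]
  {X : Type*} [TopologicalSpace X] [ChartedSpace V X]
  {F : Type*} [NormedAddCommGroup F] [NormedSpace ℂ F]
  {E : X → Type*} [∀ x, AddCommGroup (E x)] [∀ x, Module ℂ (E x)]
  [TopologicalSpace (TotalSpace F E)] [∀ x, TopologicalSpace (E x)]
  [FiberBundle F E]

theorem HermitianMetric.eq_of_forall (h : HermitianMetric V F E) {x : X} {v v' : E x}
    (hv : ∀ w, h.form x v w = h.form x v' w) : v = v' := by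
  by_contra hne
  have h1 := h.pos x (v - v') (sub_ne_zero.2 hne)
  have h2 : h.form x (v - v') (v - v') = 0 := by
    conv_lhs => rw [LinearMap.map_sub₂, hv, sub_self]
  rw [h2] at h1
  simp at h1

variable [VectorBundle ℂ F E] [FiniteDimensional ℂ F]

/-- The transposed Gram matrix `(h(σ_j, σ_i))_{i j}` of the frame `frame F E x₀` at `y`. -/
def HermitianMetric.gram (h : HermitianMetric V F E) (x₀ y : X) :
    Matrix (Fin (Module.finrank ℂ F)) (Fin (Module.finrank ℂ F)) ℂ :=
  .of fun i j ↦ h.form y (frame F E x₀ j y) (frame F E x₀ i y)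

theorem HermitianMetric.gram_mulVec (h : HermitianMetric V F E) (x₀ y : X)
    (c : Fin (Module.finrank ℂ F) → ℂ) (i : Fin (Module.finrank ℂ F)) :
    (h.gram x₀ y).mulVec c i = h.form y (∑ j, c j • frame F E x₀ j y) (frame F E x₀ i y) := by
  simp [Matrix.mulVec, dotProduct, HermitianMetric.gram, mul_comm]

theorem HermitianMetric.eq_of_forall_frame (h : HermitianMetric V F E) {x₀ y : X}
    (hy : y ∈ (trivializationAt F E x₀).baseSet) {v v' : E y}
    (hv : ∀ i, h.form y v (frame F E x₀ i y) = h.form y v' (frame F E x₀ i y)) : v = v' := by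
  classical
  refine h.eq_of_forall fun w ↦ ?_
  obtain ⟨c, hc⟩ : ∃ c : Fin (Module.finrank ℂ F) → ℂ, w = ∑ i, c i • frame F E x₀ i y :=
    ⟨_, (Function.update_self y w 0).symm.trans
      (eq_sum_coeff_smul_frame (F := F) hy (Function.update (0 : ∀ y, E y) y w))⟩
  rw [hc, map_sum, map_sum]
  simp only [LinearMap.map_smulₛₗ, hv]

theorem HermitianMetric.det_gram_ne_zero (h : HermitianMetric V F E) {x₀ y : X}
    (hy : y ∈ (trivializationAt F E x₀).baseSet) : (h.gram x₀ y).det ≠ 0 := by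
  intro hdet
  obtain ⟨c, hc, hc0⟩ := Matrix.exists_mulVec_eq_zero_iff.2 hdet
  refine hc (frame_linearIndependent hy c ?_)
  refine h.eq_of_forall_frame hy fun i ↦ ?_
  rw [← h.gram_mulVec, hc0]
  simp

variable [ContMDiffVectorBundle ω F E 𝓘(ℂ, V)]

theorem HermitianMetric.contMDiffAt_gram (h : HermitianMetric V F E) {x₀ y : X}
    (hy : y ∈ (trivializationAt F E x₀).baseSet) (i j : Fin (Module.finrank ℂ F)) :
    ContMDiffAt 𝓘(ℝ, V) 𝓘(ℝ, ℂ) ∞ (fun z ↦ h.gram x₀ z i j) y :=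
  h.smooth y _ _ (holomorphicAt_frame hy j).smoothAt (holomorphicAt_frame hy i).smoothAt

theorem mdifferentiableAt_complex_sum {ι : Type*} (S : Finset ι) {f : ι → X → ℂ} {x : X}
    (hf : ∀ i ∈ S, MDifferentiableAt 𝓘(ℝ, V) 𝓘(ℝ, ℂ) (f i) x) :
    MDifferentiableAt 𝓘(ℝ, V) 𝓘(ℝ, ℂ) (fun y ↦ ∑ i ∈ S, f i y) x ∧
      ∀ v : TangentSpace 𝓘(ℝ, V) x, del (fun y ↦ ∑ i ∈ S, f i y) x v = ∑ i ∈ S, del (f i) x v := by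
  classical
  induction S using Finset.induction_on with
  | empty =>
    simp only [Finset.sum_empty]
    exact ⟨mdifferentiableAt_const, fun v ↦ by rw [del, mvfderiv_const]; simp⟩
  | insert i S hi ih =>
    obtain ⟨h1, h2⟩ := ih fun j hj ↦ hf j (Finset.mem_insert_of_mem hj)
    have h3 := hf i (Finset.mem_insert_self i S)
    simp only [Finset.sum_insert hi]
    refine ⟨h3.add h1, fun v ↦ ?_⟩
    rw [del_add h3 h1, h2]

theorem HermitianMetric.mdifferentiableAt_frame (h : HermitianMetric V F E) {x₀ y : X}
    (hy : y ∈ (trivializationAt F E x₀).baseSet) {s : ∀ y, E y} (hs : DiffAt V F s y)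
    (j : Fin (Module.finrank ℂ F)) :
    MDifferentiableAt 𝓘(ℝ, V) 𝓘(ℝ, ℂ) (fun z ↦ h.form z (s z) (frame F E x₀ j z)) y := by
  have h1 := (mdifferentiableAt_complex_sum Finset.univ (x := y)
    (f := fun i z ↦ coeff (F := F) x₀ s i z • h.gram x₀ z j i) fun i _ ↦
      mdifferentiableAt_smul_complex (hs.coeff hy i)
        ((h.contMDiffAt_gram hy j i).mdifferentiableAt (by simp))).1
  refine h1.congr_of_eventuallyEq ?_
  filter_upwards [(trivializationAt F E x₀).open_baseSet.mem_nhds hy] with z hz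
  conv_lhs => rw [eq_sum_coeff_smul_frame (F := F) hz s]
  simp [HermitianMetric.gram]

/-- `h(s, t)` is differentiable if `s` and `t` are, and `∂ h(s, t)` is computed by expanding `t` in
a holomorphic frame. -/
theorem HermitianMetric.mdifferentiableAt_and_del (h : HermitianMetric V F E) {x₀ y : X}
    (hy : y ∈ (trivializationAt F E x₀).baseSet) {s t : ∀ y, E y} (hs : DiffAt V F s y)
    (ht : DiffAt V F t y) :
    MDifferentiableAt 𝓘(ℝ, V) 𝓘(ℝ, ℂ) (fun z ↦ h.form z (s z) (t z)) y ∧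
      ∀ v : TangentSpace 𝓘(ℝ, V) y, del (fun z ↦ h.form z (s z) (t z)) y v =
        h.form y (s y) (dbar (F := F) t y v) + ∑ j, conj (coeff (F := F) x₀ t j y) *
          del (fun z ↦ h.form z (s z) (frame F E x₀ j z)) y v := by
  have h0 (j) : MDifferentiableAt 𝓘(ℝ, V) 𝓘(ℝ, ℂ) (fun z ↦ conj (coeff (F := F) x₀ t j z)) y :=
    mdifferentiableAt_conj (ht.coeff hy j)
  have h1 := mdifferentiableAt_complex_sum Finset.univ (x := y)
    (f := fun j z ↦ conj (coeff (F := F) x₀ t j z) • h.form z (s z) (frame F E x₀ j z))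
      fun j _ ↦ mdifferentiableAt_smul_complex (h0 j) (h.mdifferentiableAt_frame hy hs j)
  have h2 : (fun z ↦ h.form z (s z) (t z)) =ᶠ[𝓝 y] fun z ↦
      ∑ j, conj (coeff (F := F) x₀ t j z) • h.form z (s z) (frame F E x₀ j z) := by
    filter_upwards [(trivializationAt F E x₀).open_baseSet.mem_nhds hy] with z hz
    conv_lhs => rw [eq_sum_coeff_smul_frame (F := F) hz t]
    simp
  refine ⟨h1.1.congr_of_eventuallyEq h2, fun v ↦ ?_⟩
  rw [del_congr h2, h1.2, dbar_eq_sum hy ht, map_sum, ← Finset.sum_add_distrib]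
  refine Finset.sum_congr rfl fun j _ ↦ ?_
  rw [del_smul (h0 j) (h.mdifferentiableAt_frame hy hs j), del_conj (ht.coeff hy j)]
  simp

theorem HermitianMetric.mdifferentiableAt (h : HermitianMetric V F E) {y : X} {s t : ∀ y, E y}
    (hs : DiffAt V F s y) (ht : DiffAt V F t y) :
    MDifferentiableAt 𝓘(ℝ, V) 𝓘(ℝ, ℂ) (fun z ↦ h.form z (s z) (t z)) y :=
  (h.mdifferentiableAt_and_del (FiberBundle.mem_baseSet_trivializationAt' y) hs ht).1

end Gram

/-! ### The `(1,0)`-part of the Chern connection -/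

section Gradient

variable {V : Type*} [NormedAddCommGroup V] [NormedSpace ℂ V]
  {X : Type*} [TopologicalSpace X] [ChartedSpace V X]
  {F : Type*} [NormedAddCommGroup F] [NormedSpace ℂ F]
  {E : X → Type*} [∀ x, AddCommGroup (E x)] [∀ x, Module ℂ (E x)]
  [TopologicalSpace (TotalSpace F E)] [∀ x, TopologicalSpace (E x)]
  [FiberBundle F E] [VectorBundle ℂ F E] [FiniteDimensional ℂ F]

/-- The `(1,0)`-part `D'_v s` of the Chern connection at `x`: the vector whose products with a
holomorphic frame `σ` are `h(D'_v s, σ_i) = ∂_v h(s, σ_i)`. -/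
def HermitianMetric.chern10 (h : HermitianMetric V F E) (s : ∀ y, E y) (x : X)
    (v : TangentSpace 𝓘(ℝ, V) x) : E x :=
  ∑ j, ((h.gram x x)⁻¹.mulVec fun i ↦
    del (fun z ↦ h.form z (s z) (frame F E x i z)) x v) j • frame F E x j x

theorem HermitianMetric.form_sum_inv_gram (h : HermitianMetric V F E) {x₀ y : X}
    (hy : y ∈ (trivializationAt F E x₀).baseSet) (r : Fin (Module.finrank ℂ F) → ℂ)
    (i : Fin (Module.finrank ℂ F)) :
    h.form y (∑ j, (h.gram x₀ y)⁻¹.mulVec r j • frame F E x₀ j y) (frame F E x₀ i y) = r i := by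
  rw [← h.gram_mulVec, Matrix.mulVec_mulVec,
    Matrix.mul_nonsing_inv _ (isUnit_iff_ne_zero.2 (h.det_gram_ne_zero hy)), Matrix.one_mulVec]

theorem HermitianMetric.chern10_cplx (h : HermitianMetric V F E) (s : ∀ y, E y) (x : X)
    (v : TangentSpace 𝓘(ℝ, V) x) : h.chern10 s x (cplx x v) = Complex.I • h.chern10 s x v := by
  have hx := FiberBundle.mem_baseSet_trivializationAt' (F := F) (E := E) x
  refine h.eq_of_forall_frame hx fun i ↦ ?_
  rw [map_smul, LinearMap.smul_apply, chern10, chern10, h.form_sum_inv_gram hx,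
    h.form_sum_inv_gram hx, del_cplx]

variable [ContMDiffVectorBundle ω F E 𝓘(ℂ, V)]

/-- The characterization of `D'` through all differentiable sections `t`. -/
theorem HermitianMetric.form_chern10 (h : HermitianMetric V F E) {x : X} {s t : ∀ y, E y}
    (hs : DiffAt V F s x) (ht : DiffAt V F t x) (v : TangentSpace 𝓘(ℝ, V) x) :
    h.form x (h.chern10 s x v) (t x) =
      del (fun z ↦ h.form z (s z) (t z)) x v - h.form x (s x) (dbar (F := F) t x v) := by
  have hx := FiberBundle.mem_baseSet_trivializationAt' (F := F) (E := E) x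
  rw [(h.mdifferentiableAt_and_del hx hs ht).2, add_sub_cancel_left]
  conv_lhs => rw [eq_sum_coeff_smul_frame (F := F) hx t]
  rw [map_sum]
  refine Finset.sum_congr rfl fun i _ ↦ ?_
  rw [LinearMap.map_smulₛₗ, chern10, h.form_sum_inv_gram hx]
  rfl

theorem HermitianMetric.form_chern10_frame (h : HermitianMetric V F E) {x₀ x : X}
    (hx : x ∈ (trivializationAt F E x₀).baseSet) {s : ∀ y, E y}
    (hs : DiffAt V F s x) (v : TangentSpace 𝓘(ℝ, V) x) (i : Fin (Module.finrank ℂ F)) :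
    h.form x (h.chern10 s x v) (frame F E x₀ i x) =
      del (fun z ↦ h.form z (s z) (frame F E x₀ i z)) x v := by
  have hi := holomorphicAt_frame (V := V) hx i
  rw [h.form_chern10 hs hi.smoothAt.diffAt, dbar_of_holomorphic hi, map_zero, sub_zero]

theorem HermitianMetric.chern10_add (h : HermitianMetric V F E) {x : X} {s t : ∀ y, E y}
    (hs : DiffAt V F s x) (ht : DiffAt V F t x) (v : TangentSpace 𝓘(ℝ, V) x) :
    h.chern10 (s + t) x v = h.chern10 s x v + h.chern10 t x v := by
  have hx := FiberBundle.mem_baseSet_trivializationAt' (F := F) (E := E) x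
  refine h.eq_of_forall_frame hx fun i ↦ ?_
  rw [map_add, LinearMap.add_apply, h.form_chern10_frame hx hs, h.form_chern10_frame hx ht,
    ← del_add (h.mdifferentiableAt_frame hx hs i) (h.mdifferentiableAt_frame hx ht i), chern10,
    h.form_sum_inv_gram hx]
  simp

theorem HermitianMetric.chern10_smul (h : HermitianMetric V F E) {x : X} {a : X → ℂ}
    {s : ∀ y, E y} (ha : MDifferentiableAt 𝓘(ℝ, V) 𝓘(ℝ, ℂ) a x) (hs : DiffAt V F s x)
    (v : TangentSpace 𝓘(ℝ, V) x) :
    h.chern10 (fun y ↦ a y • s y) x v = del a x v • s x + a x • h.chern10 s x v := by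
  have hx := FiberBundle.mem_baseSet_trivializationAt' (F := F) (E := E) x
  refine h.eq_of_forall_frame hx fun i ↦ ?_
  rw [chern10, h.form_sum_inv_gram hx, map_add, map_smul, map_smul, LinearMap.add_apply,
    LinearMap.smul_apply, LinearMap.smul_apply, h.form_chern10_frame hx hs,
    ← del_smul ha (h.mdifferentiableAt_frame hx hs i)]
  simp

variable [IsManifold 𝓘(ℂ, V) ω X]

theorem HermitianMetric.smoothAt_chern10 (h : HermitianMetric V F E) {x : X}
    {W : ∀ y : X, TangentSpace 𝓘(ℝ, V) y} {s : ∀ y, E y} (hW : SmoothAt V V W x)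
    (hs : SmoothAt V F s x) : SmoothAt V F (fun y ↦ h.chern10 s y (W y)) x := by
  have hx := FiberBundle.mem_baseSet_trivializationAt' (F := F) (E := E) x
  have h1 : SmoothAt V F (fun y ↦ ∑ j, ((h.gram x y)⁻¹.mulVec fun i ↦
      del (fun z ↦ h.form z (s z) (frame F E x i z)) y (W y)) j • frame F E x j y) x := by
    refine smoothAt_sum _ fun j _ ↦ SmoothAt.smul_fun ?_ (holomorphicAt_frame hx j).smoothAt
    unfold Matrix.mulVec dotProduct
    refine contMDiffAt_complex_sum _ fun i _ ↦ contMDiffAt_complex_mul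
      (contMDiffAt_inv_apply (fun k l ↦ h.contMDiffAt_gram hx k l) (h.det_gram_ne_zero hx) j i)
      (contMDiffAt_del ?_ hW)
    exact h.smooth x _ _ hs (holomorphicAt_frame hx i).smoothAt
  refine h1.congr ?_
  filter_upwards [(trivializationAt F E x).open_baseSet.mem_nhds hx, hs.eventually_diffAt]
    with y hy hsy
  refine h.eq_of_forall_frame hy fun i ↦ ?_
  rw [h.form_sum_inv_gram hy, h.form_chern10_frame hy hsy]

theorem smoothAt_dbar {x : X} {W : ∀ y : X, TangentSpace 𝓘(ℝ, V) y} {s : ∀ y, E y}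
    (hW : SmoothAt V V W x) (hs : SmoothAt V F s x) :
    SmoothAt V F (fun y ↦ dbar (F := F) s y (W y)) x := by
  have hx := FiberBundle.mem_baseSet_trivializationAt' (F := F) (E := E) x
  have h1 : SmoothAt V F (fun y ↦ ∑ i, delbar (coeff (F := F) x s i) y (W y) •
      frame F E x i y) x :=
    smoothAt_sum _ fun i _ ↦ SmoothAt.smul_fun (contMDiffAt_delbar (hs.coeff hx i) hW)
      (holomorphicAt_frame hx i).smoothAt
  refine h1.congr ?_
  filter_upwards [(trivializationAt F E x).open_baseSet.mem_nhds hx, hs.eventually_diffAt]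
    with y hy hsy
  exact dbar_eq_sum hy hsy _

end Gradient

/-! ### Existence of the Chern connection -/

theorem mvfderiv_ofReal {V : Type*} [NormedAddCommGroup V] [NormedSpace ℂ V]
    {X : Type*} [TopologicalSpace X] [ChartedSpace V X]
    {g : X → ℝ} {x : X} (hg : MDifferentiableAt 𝓘(ℝ, V) 𝓘(ℝ, ℝ) g x)
    (v : TangentSpace 𝓘(ℝ, V) x) :
    MDifferentiableAt 𝓘(ℝ, V) 𝓘(ℝ, ℂ) (fun y ↦ (g y : ℂ)) x ∧
      mvfderiv 𝓘(ℝ, V) (fun y ↦ (g y : ℂ)) x v = (mvfderiv 𝓘(ℝ, V) g x v : ℂ) := by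
  have h : HasMFDerivAt 𝓘(ℝ, V) 𝓘(ℝ, ℂ) (fun y ↦ (g y : ℂ)) x
      (Complex.ofRealCLM.comp (mfderiv 𝓘(ℝ, V) 𝓘(ℝ, ℝ) g x : V →L[ℝ] ℝ) : V →L[ℝ] ℂ) :=
    HasMFDerivAt.comp x Complex.ofRealCLM.hasMFDerivAt hg.hasMFDerivAt
  exact ⟨h.mdifferentiableAt, congrArg (fun L : V →L[ℝ] ℂ ↦ L v) h.mfderiv⟩

section Existence

variable {V : Type*} [NormedAddCommGroup V] [NormedSpace ℂ V] [FiniteDimensional ℂ V]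
  {X : Type*} [TopologicalSpace X] [ChartedSpace V X]
  {F : Type*} [NormedAddCommGroup F] [NormedSpace ℂ F] [FiniteDimensional ℂ F]
  {E : X → Type*} [∀ x, AddCommGroup (E x)] [∀ x, Module ℂ (E x)]
  [TopologicalSpace (TotalSpace F E)] [∀ x, TopologicalSpace (E x)]
  [∀ x, IsTopologicalAddGroup (E x)] [∀ x, ContinuousSMul ℂ (E x)]
  [FiberBundle F E] [VectorBundle ℂ F E]

/-- The Chern connection `D_v s = D'_v s + d''_v s`, as a linear map in the tangent vector `v`. -/
def HermitianMetric.chernMap (h : HermitianMetric V F E) (s : ∀ y, E y) (x : X) :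
    TangentSpace 𝓘(ℝ, V) x →L[ℝ] E x :=
  haveI : FiniteDimensional ℝ (TangentSpace 𝓘(ℝ, V) x) :=
    (FiniteDimensional.complexToReal V : FiniteDimensional ℝ V)
  haveI : T2Space (TangentSpace 𝓘(ℝ, V) x) := (inferInstance : T2Space V)
  LinearMap.toContinuousLinearMap
  { toFun := fun v ↦ h.chern10 s x v + dbar (F := F) s x v
    map_add' := fun u v ↦ by
      have hx := FiberBundle.mem_baseSet_trivializationAt' (F := F) (E := E) x
      have h1 : h.chern10 s x (u + v) = h.chern10 s x u + h.chern10 s x v := by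
        refine h.eq_of_forall_frame hx fun i ↦ ?_
        rw [map_add, LinearMap.add_apply, chern10, chern10, chern10, h.form_sum_inv_gram hx,
          h.form_sum_inv_gram hx, h.form_sum_inv_gram hx]
        simp only [del, map_add]
        module
      have h2 : dbar (F := F) s x (u + v) = dbar (F := F) s x u + dbar (F := F) s x v := by
        rw [dbar_eq, dbar_eq, dbar_eq, ← map_add]
        congr 1
        simp only [delbar, map_add]
        module
      rw [h1, h2]
      abel
    map_smul' := fun c v ↦ by
      have hx := FiberBundle.mem_baseSet_trivializationAt' (F := F) (E := E) x
      have h1 : h.chern10 s x (c • v) = (c : ℂ) • h.chern10 s x v := by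
        refine h.eq_of_forall_frame hx fun i ↦ ?_
        rw [map_smul, LinearMap.smul_apply, chern10, chern10, h.form_sum_inv_gram hx,
          h.form_sum_inv_gram hx]
        simp only [del, map_smul, ← Complex.coe_smul c]
        module
      have h2 : dbar (F := F) s x (c • v) = (c : ℂ) • dbar (F := F) s x v := by
        rw [dbar_eq, dbar_eq, ← map_smul]
        congr 1
        simp only [delbar, map_smul, ← Complex.coe_smul c]
        module
      rw [h1, h2, ← smul_add]
      rfl }

theorem HermitianMetric.chernMap_apply (h : HermitianMetric V F E) (s : ∀ y, E y) (x : X)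
    (v : TangentSpace 𝓘(ℝ, V) x) :
    h.chernMap s x v = h.chern10 s x v + dbar (F := F) s x v := rfl

variable [ContMDiffVectorBundle ω F E 𝓘(ℂ, V)]

theorem HermitianMetric.chernMap_smul (h : HermitianMetric V F E) {x : X} {a : X → ℂ}
    {s : ∀ y, E y} (ha : MDifferentiableAt 𝓘(ℝ, V) 𝓘(ℝ, ℂ) a x) (hs : DiffAt V F s x)
    (v : TangentSpace 𝓘(ℝ, V) x) :
    h.chernMap (fun y ↦ a y • s y) x v =
      a x • h.chernMap s x v + mvfderiv 𝓘(ℝ, V) a x v • s x := by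
  rw [chernMap_apply, chernMap_apply, h.chern10_smul ha hs, dbar_smul ha hs,
    ← del_add_delbar a x v]
  module

variable [IsManifold 𝓘(ℂ, V) ω X]

/-- The Chern connection of a hermitian metric. -/
def HermitianMetric.chern (h : HermitianMetric V F E) : Connection V F E where
  toFun := h.chernMap
  isCovariantDerivativeOnUniv :=
    { add := fun {s t x} hs ht _ ↦ by
        ext v
        simp only [add_apply, chernMap_apply]
        rw [h.chern10_add hs ht, dbar_add hs ht]
        abel
      leibniz := fun {s g x} hs hg _ ↦ by
        ext v
        have h1 := h.chernMap_smul (mvfderiv_ofReal hg v).1 hs v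
        rw [(mvfderiv_ofReal hg v).2, Complex.coe_smul, Complex.coe_smul] at h1
        exact h1 }
  map_I_smul := fun x s hs v ↦ by
    rw [h.chernMap_smul mdifferentiableAt_const hs, mvfderiv_const]
    simp
  smooth := fun x W s hW hs ↦ (h.smoothAt_chern10 hW hs).add (smoothAt_dbar hW hs)

theorem HermitianMetric.isChernConnection_chern (h : HermitianMetric V F E) :
    IsChernConnection h.chern h where
  antihol_eq := fun x s _ v ↦ by
    change (1 / 2 : ℂ) • (h.chernMap s x v + Complex.I • h.chernMap s x (cplx x v)) = _
    rw [chernMap_apply, chernMap_apply, h.chern10_cplx, dbar_cplx, smul_add Complex.I, smul_smul Complex.I,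
      smul_smul Complex.I,
      mul_neg, Complex.I_mul_I]
    module
  metric := fun x s t hs ht v ↦ by
    change _ = h.form x (h.chernMap s x v) (t x) + h.form x (s x) (h.chernMap t x v)
    have h1 : delbar (fun y ↦ h.form y (s y) (t y)) x v =
        conj (del (fun y ↦ h.form y (t y) (s y)) x v) := by
      rw [← delbar_conj (h.mdifferentiableAt ht hs)]
      simp only [h.conj_symm]
    rw [chernMap_apply, chernMap_apply, map_add, map_add, LinearMap.add_apply,
      h.form_chern10 hs ht, ← h.conj_symm x (s x) (h.chern10 t x v), h.form_chern10 ht hs,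
      ← del_add_delbar, h1, map_sub, h.conj_symm]
    ring

end Existence

/-! ### Endomorphism-valued forms -/

section EndForms

variable {V : Type*} [NormedAddCommGroup V] [NormedSpace ℂ V]
  {X : Type*} [TopologicalSpace X] [ChartedSpace V X]
  {E : X → Type*} [∀ x, AddCommGroup (E x)] [∀ x, Module ℂ (E x)]

theorem TwoForm.ext_bilin {B C : TwoForm V E}
    (h : ∀ x (u v : TangentSpace 𝓘(ℝ, V) x), bilin (B x) u v = bilin (C x) u v) : B = C := by
  funext x
  ext1 v
  rw [apply_eq_bilin (B x), apply_eq_bilin (C x), h]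

theorem TwoForm.bilin_part11 (B : TwoForm V E) (x : X) (u v : TangentSpace 𝓘(ℝ, V) x) :
    bilin (B.part11 x) u v =
      (1 / 2 : ℂ) • (bilin (B x) u v + bilin (B x) (cplx x u) (cplx x v)) := rfl

theorem TwoForm.bilin_part20 (B : TwoForm V E) (x : X) (u v : TangentSpace 𝓘(ℝ, V) x) :
    bilin (B.part20 x) u v =
      (1 / 4 : ℂ) • (bilin (B x) u v - bilin (B x) (cplx x u) (cplx x v)
        - Complex.I • (bilin (B x) (cplx x u) v + bilin (B x) u (cplx x v))) := rfl

theorem TwoForm.part11_eq_self {B : TwoForm V E}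
    (h : ∀ x (u v : TangentSpace 𝓘(ℝ, V) x),
      bilin (B x) (cplx x u) (cplx x v) = bilin (B x) u v) : B.part11 = B := by
  refine TwoForm.ext_bilin fun x u v ↦ ?_
  rw [TwoForm.bilin_part11, h]
  module

theorem TwoForm.part20_eq_zero {B : TwoForm V E}
    (h : ∀ x (u v : TangentSpace 𝓘(ℝ, V) x),
      bilin (B x) (cplx x u) (cplx x v) = bilin (B x) u v) : B.part20 = 0 := by
  refine TwoForm.ext_bilin fun x u v ↦ ?_
  have h1 : bilin (B x) (cplx x u) v = -bilin (B x) u (cplx x v) := by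
    rw [← h x u (cplx x v), cplx_cplx, map_neg, neg_neg]
  rw [TwoForm.bilin_part20, h, h1, sub_self, neg_add_cancel, smul_zero, sub_zero, smul_zero]
  rfl

theorem TwoForm.bilin_cplx_right {B : TwoForm V E}
    (h : ∀ x (u v : TangentSpace 𝓘(ℝ, V) x),
      bilin (B x) (cplx x u) v = Complex.I • bilin (B x) u v)
    (x : X) (u v : TangentSpace 𝓘(ℝ, V) x) :
    bilin (B x) u (cplx x v) = Complex.I • bilin (B x) u v := by
  rw [bilin_swap, h, bilin_swap (B x) v u, smul_neg]

theorem TwoForm.part11_eq_zero {B : TwoForm V E}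
    (h : ∀ x (u v : TangentSpace 𝓘(ℝ, V) x),
      bilin (B x) (cplx x u) v = Complex.I • bilin (B x) u v) : B.part11 = 0 := by
  refine TwoForm.ext_bilin fun x u v ↦ ?_
  rw [TwoForm.bilin_part11, h, TwoForm.bilin_cplx_right h, smul_smul, Complex.I_mul_I,
    neg_one_smul, add_neg_cancel, smul_zero]
  rfl

theorem TwoForm.part20_eq_self {B : TwoForm V E}
    (h : ∀ x (u v : TangentSpace 𝓘(ℝ, V) x),
      bilin (B x) (cplx x u) v = Complex.I • bilin (B x) u v) : B.part20 = B := by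
  refine TwoForm.ext_bilin fun x u v ↦ ?_
  have h2 : Complex.I * Complex.I = -1 := Complex.I_mul_I
  rw [TwoForm.bilin_part20, h, h, TwoForm.bilin_cplx_right h, smul_add, smul_smul, h2]
  module

theorem bracket_self (Φ : OneForm V E) : bracket Φ Φ = (2 : ℂ) • wedge Φ Φ := by
  rw [bracket]
  module

theorem bracket_self_eq_zero_iff (Φ : OneForm V E) : bracket Φ Φ = 0 ↔ wedge Φ Φ = 0 := by
  rw [bracket_self, smul_eq_zero_iff_right two_ne_zero]

theorem wedge_smul_smul (a b : ℂ) (Φ Ψ : OneForm V E) :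
    wedge (a • Φ) (b • Ψ) = (a * b) • wedge Φ Ψ := by
  funext x
  ext1 v
  change (a • Φ x (v 0)) * (b • Ψ x (v 1)) - (a • Φ x (v 1)) * (b • Ψ x (v 0)) =
    (a * b) • (Φ x (v 0) * Ψ x (v 1) - Φ x (v 1) * Ψ x (v 0))
  simp only [smul_mul_smul_comm, smul_sub]

theorem bracket_smul_smul (a b : ℂ) (Φ Ψ : OneForm V E) :
    bracket (a • Φ) (b • Ψ) = (a * b) • bracket Φ Ψ := by
  rw [bracket, bracket, wedge_smul_smul, wedge_smul_smul, mul_comm b a, smul_sub,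
    smul_comm (a * b)]

variable {F : Type*} [NormedAddCommGroup F] [NormedSpace ℂ F]
  [TopologicalSpace (TotalSpace F E)] [∀ x, TopologicalSpace (E x)] [FiberBundle F E]
  [VectorBundle ℂ F E]

theorem HermitianMetric.conjForm_smul [FiniteDimensional ℂ F] (h : HermitianMetric V F E) (c : ℂ)
    (Φ : OneForm V E) : h.conjForm (c • Φ) = conj c • h.conjForm Φ := by
  funext x
  ext v s
  refine h.eq_of_forall fun w ↦ ?_
  change h.form x (h.adjoint x ((c • Φ) x v) s) w = h.form x (conj c • h.adjoint x (Φ x v) s) w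
  rw [h.adjoint_spec, map_smul, LinearMap.smul_apply, h.adjoint_spec]
  exact LinearMap.map_smulₛₗ _ c _

theorem HolomorphicAt.smul (c : ℂ) {s : ∀ y, E y} {x : X} (hs : HolomorphicAt V F s x) :
    HolomorphicAt V F (fun y ↦ c • s y) x := by
  unfold HolomorphicAt at hs ⊢
  rw [contMDiffAt_section] at hs ⊢
  refine ContMDiffAt.congr_of_eventuallyEq ?_ (coord_smul c s x)
  exact (ContinuousLinearMap.contMDiff
    ((ContinuousLinearMap.lsmul ℂ ℂ c : F →L[ℂ] F))).contMDiffAt.comp x hs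

variable [IsManifold 𝓘(ℂ, V) ω X]

theorem OneZeroForm.toForm_smul (c : ℂ) (Φ : OneZeroForm V F E) :
    (c • Φ).toForm = c • Φ.toForm := rfl

theorem IsHiggsField.smul (c : ℂ) {Φ : OneZeroForm V F E} (hΦ : IsHiggsField Φ) :
    IsHiggsField (c • Φ) where
  holomorphic x W s hW hs := (hΦ.holomorphic x W s hW hs).smul c
  wedge_self := by
    rw [OneZeroForm.toForm_smul, wedge_smul_smul, hΦ.wedge_self, smul_zero]

end EndForms

/-! ### Curvature of the Chern connection -/

section Curvature

variable {V : Type*} [NormedAddCommGroup V] [NormedSpace ℂ V]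
  {X : Type*} [TopologicalSpace X] [ChartedSpace V X] [IsManifold 𝓘(ℂ, V) ω X]
  {F : Type*} [NormedAddCommGroup F] [NormedSpace ℂ F]
  {E : X → Type*} [∀ x, AddCommGroup (E x)] [∀ x, Module ℂ (E x)]
  [TopologicalSpace (TotalSpace F E)] [∀ x, TopologicalSpace (E x)]
  [∀ x, IsTopologicalAddGroup (E x)] [∀ x, ContinuousSMul ℂ (E x)]
  [FiberBundle F E] [VectorBundle ℂ F E]
  {D : Connection V F E} {h : HermitianMetric V F E}

/-- The Chern connection differentiates holomorphic sections complex linearly. -/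
theorem IsChernConnection.toFun_cplx (hD : IsChernConnection D h) {s : ∀ y, E y} {x : X}
    (hs : HolomorphicAt V F s x) (v : TangentSpace 𝓘(ℝ, V) x) :
    D.toFun s x (cplx x v) = Complex.I • D.toFun s x v := by
  have h1 := hD.antihol_eq x s hs.smoothAt.diffAt v
  rw [dbar_of_holomorphic hs, Connection.antihol,
    smul_eq_zero_iff_right (by norm_num : (1 / 2 : ℂ) ≠ 0)] at h1
  rw [eq_neg_of_add_eq_zero_left h1, smul_neg, smul_smul, Complex.I_mul_I, neg_one_smul, neg_neg]

theorem smoothAt_toFun_ext {x : X} (v : TangentSpace 𝓘(ℝ, V) x) (e : E x) :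
    SmoothAt V F (fun y ↦ D.toFun (ext ℂ F e) y (ext ℝ V v y)) x :=
  D.smooth x _ _ (Connection.smoothAt_extTangent v) (Connection.smoothAt_ext e)

variable [ContMDiffVectorBundle ω F E 𝓘(ℂ, V)]

theorem IsChernConnection.toFun_toFun_ext_cplx (hD : IsChernConnection D h) {x : X}
    (u v : TangentSpace 𝓘(ℝ, V) x) (e : E x) :
    D.toFun (fun y ↦ D.toFun (ext ℂ F e) y (ext ℝ V (cplx x v) y)) x u =
      Complex.I • D.toFun (fun y ↦ D.toFun (ext ℂ F e) y (ext ℝ V v y)) x u := by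
  rw [← D.map_smul _ (smoothAt_toFun_ext v e).diffAt]
  refine DFunLike.congr_fun (D.congr (smoothAt_toFun_ext (cplx x v) e).diffAt
    ((smoothAt_toFun_ext v e).smul _).diffAt ?_) u
  filter_upwards [chart_source_mem_nhds V x, (trivializationAt F E x).open_baseSet.mem_nhds
    (FiberBundle.mem_baseSet_trivializationAt' x)] with y hy hy'
  rw [ext_cplx hy, hD.toFun_cplx (holomorphicAt_ext_section hy' e)]

variable [FiniteDimensional ℂ V]

/-- Coordinate fields commute, so that the curvature is a commutator of covariant derivatives. -/
theorem Connection.bilin_curvature_apply (D : Connection V F E) {x : X}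
    (u v : TangentSpace 𝓘(ℝ, V) x) (e : E x) :
    bilin (D.curvature x) u v e =
      D.toFun (fun y ↦ D.toFun (ext ℂ F e) y (ext ℝ V v y)) x u -
        D.toFun (fun y ↦ D.toFun (ext ℂ F e) y (ext ℝ V u y)) x v := by
  change D.curvatureOn (ext ℝ V u) (ext ℝ V v) (ext ℂ F e) x = _
  rw [Connection.curvatureOn, mlieBracket_ext, map_zero, sub_zero, ext_self, ext_self]

/-- The `(0,2)`-part of the curvature vanishes, as `D'' D'' = 0`. -/
theorem IsChernConnection.curvature02 (hD : IsChernConnection D h) {x : X}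
    (u v : TangentSpace 𝓘(ℝ, V) x) :
    bilin (D.curvature x) u v - bilin (D.curvature x) (cplx x u) (cplx x v) =
      -Complex.I • (bilin (D.curvature x) (cplx x u) v + bilin (D.curvature x) u (cplx x v)) := by
  ext e
  have h2 : Complex.I * Complex.I = -1 := Complex.I_mul_I
  simp only [LinearMap.sub_apply, LinearMap.add_apply, LinearMap.smul_apply,
    D.bilin_curvature_apply, hD.toFun_toFun_ext_cplx, smul_add, smul_sub, smul_smul, neg_mul, h2]
  module

/-- The curvature of a metric connection is skew-hermitian. -/
theorem IsChernConnection.curvature_skew [FiniteDimensional ℂ F] (hD : IsChernConnection D h)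
    {x : X} (u v : TangentSpace 𝓘(ℝ, V) x) (a b : E x) :
    h.form x (bilin (D.curvature x) u v a) b = -h.form x a (bilin (D.curvature x) u v b) := by
  set s := ext ℂ F a with hs_def
  set t := ext ℂ F b with ht_def
  have hs : SmoothAt V F s x := Connection.smoothAt_ext a
  have ht : SmoothAt V F t x := Connection.smoothAt_ext b
  have key (u v : TangentSpace 𝓘(ℝ, V) x) :
      mvfderiv 𝓘(ℝ, V) (fun y ↦ mvfderiv 𝓘(ℝ, V) (fun z ↦ h.form z (s z) (t z)) y (ext ℝ V u y))
        x v =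
      (h.form x (D.toFun (fun y ↦ D.toFun s y (ext ℝ V u y)) x v) b +
        h.form x (D.toFun s x u) (D.toFun t x v)) +
      (h.form x (D.toFun s x v) (D.toFun t x u) +
        h.form x a (D.toFun (fun y ↦ D.toFun t y (ext ℝ V u y)) x v)) := by
    have h1 : (fun y ↦ mvfderiv 𝓘(ℝ, V) (fun z ↦ h.form z (s z) (t z)) y (ext ℝ V u y)) =ᶠ[𝓝 x]
        fun y ↦ h.form y (D.toFun s y (ext ℝ V u y)) (t y) +
          h.form y (s y) (D.toFun t y (ext ℝ V u y)) := by
      filter_upwards [hs.eventually_diffAt, ht.eventually_diffAt] with y hy hy'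
      exact hD.metric y s t hy hy' _
    have h2 : DiffAt V F (fun y ↦ D.toFun s y (ext ℝ V u y)) x := (smoothAt_toFun_ext u a).diffAt
    have h3 : DiffAt V F (fun y ↦ D.toFun t y (ext ℝ V u y)) x := (smoothAt_toFun_ext u b).diffAt
    rw [mvfderiv_eq_of_eventuallyEq h1, mvfderiv_fun_add (h.mdifferentiableAt h2 ht.diffAt)
      (h.mdifferentiableAt hs.diffAt h3), add_apply, hD.metric x _ t h2 ht.diffAt,
      hD.metric x s _ hs.diffAt h3, hs_def, ht_def, ext_self, ext_self, ext_self]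
  have h4 := mvfderiv_ext_comm (h.smooth x s t hs ht) u v
  rw [key, key] at h4
  rw [D.bilin_curvature_apply, D.bilin_curvature_apply, map_sub, map_sub, LinearMap.sub_apply]
  linear_combination -h4

/-- The curvature of the Chern connection is invariant under the complex structure. -/
theorem IsChernConnection.curvature_cplx_cplx [FiniteDimensional ℂ F] (hD : IsChernConnection D h)
    (x : X) (u v : TangentSpace 𝓘(ℝ, V) x) :
    bilin (D.curvature x) (cplx x u) (cplx x v) = bilin (D.curvature x) u v := by
  symm
  rw [← sub_eq_zero]
  ext a
  refine h.eq_of_forall fun b ↦ ?_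
  -- `Y = -i Z` with `Y`, `Z` skew-hermitian; passing to adjoints gives `-Y = -i Z` as well.
  have h1 (a : E x) := LinearMap.congr_fun (hD.curvature02 u v) a
  have hY : h.form x ((bilin (D.curvature x) u v -
        bilin (D.curvature x) (cplx x u) (cplx x v)) a) b =
      -h.form x a ((bilin (D.curvature x) u v -
        bilin (D.curvature x) (cplx x u) (cplx x v)) b) := by
    simp only [LinearMap.sub_apply, map_sub, hD.curvature_skew]
    ring
  have hZ : h.form x ((bilin (D.curvature x) u v -
        bilin (D.curvature x) (cplx x u) (cplx x v)) a) b =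
      h.form x a ((bilin (D.curvature x) u v -
        bilin (D.curvature x) (cplx x u) (cplx x v)) b) := by
    rw [h1, h1]
    simp only [LinearMap.smul_apply, LinearMap.add_apply, map_add, LinearMap.map_smulₛₗ,
      hD.curvature_skew, smul_eq_mul, RingHom.id_apply, map_neg, Complex.conj_I]
    ring
  rw [hY] at hZ
  rw [hY, LinearMap.zero_apply, map_zero, LinearMap.zero_apply]
  linear_combination (1 / 2 : ℂ) * hZ

end Curvature

/-! ### The exterior covariant derivative of a Higgs field -/

section Higgs

variable {V : Type*} [NormedAddCommGroup V] [NormedSpace ℂ V]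
  {X : Type*} [TopologicalSpace X] [ChartedSpace V X] [IsManifold 𝓘(ℂ, V) ω X]
  {F : Type*} [NormedAddCommGroup F] [NormedSpace ℂ F]
  {E : X → Type*} [∀ x, AddCommGroup (E x)] [∀ x, Module ℂ (E x)]
  [TopologicalSpace (TotalSpace F E)] [∀ x, TopologicalSpace (E x)]
  [∀ x, IsTopologicalAddGroup (E x)] [∀ x, ContinuousSMul ℂ (E x)]
  [FiberBundle F E] [VectorBundle ℂ F E]

theorem OneZeroForm.smoothAt_ext_ext (Φ : OneZeroForm V F E) {x : X}
    (v : TangentSpace 𝓘(ℝ, V) x) (e : E x) :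
    SmoothAt V F (fun y ↦ Φ.toForm y (ext ℝ V v y) (ext ℂ F e y)) x :=
  Φ.smooth x _ _ (Connection.smoothAt_extTangent v) (Connection.smoothAt_ext e)

variable [FiniteDimensional ℂ V] [ContMDiffVectorBundle ω F E 𝓘(ℂ, V)]
  {D : Connection V F E} {h : HermitianMetric V F E} {Φ : OneZeroForm V F E}

theorem Connection.bilin_extDeriv_apply (D : Connection V F E) (Φ : OneZeroForm V F E) {x : X}
    (u v : TangentSpace 𝓘(ℝ, V) x) (e : E x) :
    bilin (D.extDeriv Φ x) u v e =
      (D.toFun (fun y ↦ Φ.toForm y (ext ℝ V v y) (ext ℂ F e y)) x u -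
        Φ.toForm x v (D.toFun (ext ℂ F e) x u)) -
      (D.toFun (fun y ↦ Φ.toForm y (ext ℝ V u y) (ext ℂ F e y)) x v -
        Φ.toForm x u (D.toFun (ext ℂ F e) x v)) := by
  change D.extDerivOn Φ.toForm (ext ℝ V u) (ext ℝ V v) (ext ℂ F e) x = _
  rw [Connection.extDerivOn, mlieBracket_ext, map_zero, LinearMap.zero_apply, sub_zero, ext_self,
    ext_self]

/-- For a Higgs field `Φ`, the form `D Φ` is complex bilinear: evaluated on holomorphic vector
fields and sections, only holomorphic sections get differentiated. -/
theorem IsChernConnection.extDeriv_cplx (hD : IsChernConnection D h) (hΦ : IsHiggsField Φ) (x : X)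
    (u v : TangentSpace 𝓘(ℝ, V) x) :
    bilin (D.extDeriv Φ x) (cplx x u) v = Complex.I • bilin (D.extDeriv Φ x) u v := by
  ext e
  have he : HolomorphicAt V F (ext ℂ F e) x :=
    holomorphicAt_ext_section (FiberBundle.mem_baseSet_trivializationAt' x) e
  have h1 : HolomorphicAt V F (fun y ↦ Φ.toForm y (ext ℝ V v y) (ext ℂ F e y)) x :=
    hΦ.holomorphic x (fun y ↦ (ext ℝ V v y : V)) _ (holomorphicAt_ext v) he
  have h2 : D.toFun (fun y ↦ Φ.toForm y (ext ℝ V (cplx x u) y) (ext ℂ F e y)) x v =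
      Complex.I • D.toFun (fun y ↦ Φ.toForm y (ext ℝ V u y) (ext ℂ F e y)) x v := by
    rw [← D.map_smul _ (Φ.smoothAt_ext_ext u e).diffAt]
    refine DFunLike.congr_fun (D.congr (Φ.smoothAt_ext_ext (cplx x u) e).diffAt
      ((Φ.smoothAt_ext_ext u e).smul _).diffAt ?_) v
    filter_upwards [chart_source_mem_nhds V x] with y hy
    rw [ext_cplx hy, Φ.type10, LinearMap.smul_apply]
  rw [LinearMap.smul_apply, D.bilin_extDeriv_apply, D.bilin_extDeriv_apply, hD.toFun_cplx h1,
    hD.toFun_cplx he, h2, Φ.type10, map_smul, LinearMap.smul_apply, smul_sub, smul_sub, smul_sub]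

theorem Connection.extDeriv_smul (D : Connection V F E) (c : ℂ) (Φ : OneZeroForm V F E) :
    D.extDeriv (c • Φ) = c • D.extDeriv Φ := by
  refine TwoForm.ext_bilin fun x u v ↦ ?_
  ext e
  change _ = c • bilin (D.extDeriv Φ x) u v e
  have h1 (u v : TangentSpace 𝓘(ℝ, V) x) :
      D.toFun (fun y ↦ (c • Φ).toForm y (ext ℝ V v y) (ext ℂ F e y)) x u =
        c • D.toFun (fun y ↦ Φ.toForm y (ext ℝ V v y) (ext ℂ F e y)) x u :=
    D.map_smul c (Φ.smoothAt_ext_ext v e).diffAt u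
  rw [D.bilin_extDeriv_apply, D.bilin_extDeriv_apply, h1, h1]
  change _ - c • Φ.toForm x v _ - (_ - c • Φ.toForm x u _) = _
  rw [smul_sub, smul_sub, smul_sub]

end Higgs

end HiggsBundle

end

theorem mainTheorem2 {V : Type*} [NormedAddCommGroup V] [NormedSpace ℂ V] [FiniteDimensional ℂ V]
    {X : Type*} [TopologicalSpace X] [ChartedSpace V X] [IsManifold 𝓘(ℂ, V) ω X]
    {F : Type*} [NormedAddCommGroup F] [NormedSpace ℂ F] [FiniteDimensional ℂ F]
    {E : X → Type*} [∀ x, AddCommGroup (E x)] [∀ x, Module ℂ (E x)]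
    [TopologicalSpace (TotalSpace F E)] [∀ x, TopologicalSpace (E x)]
    [∀ x, IsTopologicalAddGroup (E x)] [∀ x, ContinuousSMul ℂ (E x)]
    [FiberBundle F E] [VectorBundle ℂ F E] [ContMDiffVectorBundle ω F E 𝓘(ℂ, V)]
    (h : HiggsBundle.HermitianMetric V F E) :
    (∃ D : HiggsBundle.Connection V F E, HiggsBundle.IsChernConnection D h) ∧
    ∀ D : HiggsBundle.Connection V F E, HiggsBundle.IsChernConnection D h →
      (D.curvature.IsType 1 1 ∧ D.curvature.part11 = D.curvature ∧ D.curvature.part20 = 0) ∧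
      ∀ Φ : HiggsBundle.OneZeroForm V F E,
        (HiggsBundle.bracket Φ.toForm Φ.toForm = 0 ↔ HiggsBundle.wedge Φ.toForm Φ.toForm = 0) ∧
        (HiggsBundle.IsHiggsField Φ →
          HiggsBundle.bracket Φ.toForm Φ.toForm = 0 ∧
          D.delDoublePrime Φ = 0 ∧
          D.extDeriv Φ = D.delPrime Φ ∧
          (D.extDeriv Φ = 0 ↔ D.delPrime Φ = 0) ∧
          HiggsBundle.IsHiggsField ((1 / 2 : ℂ) • Φ) ∧
          (HiggsBundle.WardEquations D h Φ ↔
            HiggsBundle.ReducedEquations D h ((1 / 2 : ℂ) • Φ))) := by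
  refine ⟨⟨h.chern, h.isChernConnection_chern⟩, fun D hD ↦ ?_⟩
  have h11 : D.curvature.part11 = D.curvature :=
    HiggsBundle.TwoForm.part11_eq_self hD.curvature_cplx_cplx
  have h20 : D.curvature.part20 = 0 :=
    HiggsBundle.TwoForm.part20_eq_zero hD.curvature_cplx_cplx
  refine ⟨⟨h11 ▸ HiggsBundle.TwoForm.isType_part11 _, h11, h20⟩, fun Φ ↦
    ⟨HiggsBundle.bracket_self_eq_zero_iff _, fun hΦ ↦ ?_⟩⟩
  have hbr := (HiggsBundle.bracket_self_eq_zero_iff Φ.toForm).2 hΦ.wedge_self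
  have hd : D.extDeriv Φ = D.delPrime Φ :=
    (HiggsBundle.TwoForm.part20_eq_self (hD.extDeriv_cplx hΦ)).symm
  have hΨ : HiggsBundle.IsHiggsField ((1 / 2 : ℂ) • Φ) := hΦ.smul _
  have hdΨ : D.delPrime ((1 / 2 : ℂ) • Φ) = (1 / 2 : ℂ) • D.extDeriv Φ := by
    rw [← D.extDeriv_smul]
    exact HiggsBundle.TwoForm.part20_eq_self (hD.extDeriv_cplx hΨ)
  have hcΨ : HiggsBundle.bracket ((1 / 2 : ℂ) • Φ).toForm (h.conjForm ((1 / 2 : ℂ) • Φ).toForm) =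
      (1 / 4 : ℂ) • HiggsBundle.bracket Φ.toForm (h.conjForm Φ.toForm) := by
    rw [HiggsBundle.OneZeroForm.toForm_smul, h.conjForm_smul, HiggsBundle.bracket_smul_smul]
    congr 1
    simp only [map_div₀, map_one, Complex.conj_ofNat]
    norm_num
  refine ⟨hbr, HiggsBundle.TwoForm.part11_eq_zero (hD.extDeriv_cplx hΦ), hd, by rw [hd], hΨ, ?_⟩
  refine ⟨fun hW ↦ ⟨?_, ?_⟩, fun hR ↦ ⟨?_, ?_, hbr, h20⟩⟩
  · rw [hdΨ, hW.parallel, smul_zero]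
  · rw [hcΨ, ← h11]
    exact hW.curvature
  · have h1 := hR.parallel
    rwa [hdΨ, smul_eq_zero_iff_right (by norm_num)] at h1
  · have h1 := hR.curvature
    rwa [hcΨ, ← h11] at h1
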